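/- For each integer $n\ge 2$ let $r=r_n\in[0,1/2]$, and let $(G_{ij})_{1\le i<j\le n}$ be a centered (jointly) Gaussian field with \[ \mathbb{E}(G_{ij}G_{kl})=\begin{cases}0 & \text{if } |\{i,j\}\cap\{k,l\}|=0,\\ r_n & \text{if } |\{i,j\}\cap\{k,l\}|=1,\\ 1 & \text{if } |\{i,j\}\cap\{k,l\}|=2.\end{cases} \] Put $c_n=\sqrt{2\log n}$, and suppose that \[ (1-2r_n)\,\frac{\sqrt{\log n}}{\log\log n}\longrightarrow\infty\qquad (n\to\infty). \] Then, as $n\to\infty$, \[ \sqrt2\,c_n\Bigl(\max_{1\le i<j\le n}G_{ij}-\sqrt2\,c_n+\frac{\log(4\sqrt{\pi}\,c_n)}{\sqrt2\,c_n}\Bigr) \] converges in distribution to the standard Gumbel law, whose distribution function is $x\mapsto\exp(-e^{-x})$. -/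

import Mathlib

open MeasureTheory ProbabilityTheory Filter Topology

/-- The index set of the field: the pairs `i < j` of elements of an `n`-element set. -/
abbrev UpperPair (n : ℕ) : Type := {p : Fin n × Fin n // p.1 < p.2}

namespace UpperPair

/-- The two-element set `{i, j}` underlying a pair `i < j`. -/
def support {n : ℕ} (p : UpperPair n) : Finset (Fin n) := {p.1.1, p.1.2}

/-- The number `|{i, j} ∩ {k, l}| ∈ {0, 1, 2}` of indices shared by two pairs. -/
def overlap {n : ℕ} (p q : UpperPair n) : ℕ := (p.support ∩ q.support).card

end UpperPair

/-- `G` is, under `P`, a centered jointly Gaussian field indexed by the pairs `i < j` with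
`E (G_p G_q) = 0, r, 1` according to whether `p` and `q` share `0`, `1` or `2` indices. -/
structure IsSparseEquicorrelatedField {Ω : Type*} [MeasurableSpace Ω] (n : ℕ) (r : ℝ)
    (G : UpperPair n → Ω → ℝ) (P : Measure Ω) : Prop where
  isGaussianProcess : IsGaussianProcess G P
  centered : ∀ p, ∫ ω, G p ω ∂P = 0
  cov_zero : ∀ p q, p.overlap q = 0 → ∫ ω, G p ω * G q ω ∂P = 0
  cov_one : ∀ p q, p.overlap q = 1 → ∫ ω, G p ω * G q ω ∂P = r
  cov_two : ∀ p q, p.overlap q = 2 → ∫ ω, G p ω * G q ω ∂P = 1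

/-- The maximum of the field. For `n ≥ 2` this is a maximum over a finite non-empty set. -/
noncomputable def fieldMax {Ω : Type*} {n : ℕ} (G : UpperPair n → Ω → ℝ) (ω : Ω) : ℝ :=
  ⨆ p : UpperPair n, G p ω

/-- The sequence `c_n = √(2 log n)`. -/
noncomputable def cSeq (n : ℕ) : ℝ := √(2 * Real.log n)

/-- The standard Gumbel distribution function `x ↦ exp (-exp (-x))`. -/
noncomputable def gumbelStieltjes : StieltjesFunction ℝ where
  toFun x := Real.exp (-Real.exp (-x))
  mono' := fun x y h => by
    have h1 : Real.exp (-y) ≤ Real.exp (-x) := Real.exp_le_exp.2 (neg_le_neg h)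
    exact Real.exp_le_exp.2 (neg_le_neg h1)
  right_continuous' := fun x =>
    (show Continuous fun x : ℝ => Real.exp (-Real.exp (-x)) by fun_prop).continuousWithinAt

/-- The standard Gumbel law on the real line. -/
noncomputable def gumbelMeasure : Measure ℝ := gumbelStieltjes.measure

theorem gumbelStieltjes_tendsto_atBot : Tendsto gumbelStieltjes atBot (𝓝 0) :=
  Real.tendsto_exp_neg_atTop_nhds_zero.comp (Real.tendsto_exp_atTop.comp tendsto_neg_atBot_atTop)

theorem gumbelStieltjes_tendsto_atTop : Tendsto gumbelStieltjes atTop (𝓝 1) := by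
  have h : Tendsto (fun x : ℝ => Real.exp (-Real.exp (-x))) atTop (𝓝 (Real.exp (-0))) :=
    (Real.continuous_exp.tendsto _).comp Real.tendsto_exp_neg_atTop_nhds_zero.neg
  rw [neg_zero, Real.exp_zero] at h
  exact h

instance gumbelMeasure_isProbabilityMeasure : IsProbabilityMeasure gumbelMeasure :=
  gumbelStieltjes.isProbabilityMeasure gumbelStieltjes_tendsto_atBot gumbelStieltjes_tendsto_atTop

theorem cdf_gumbelMeasure (x : ℝ) : cdf gumbelMeasure x = Real.exp (-Real.exp (-x)) := by
  rw [gumbelMeasure, cdf_measure_stieltjesFunction _ gumbelStieltjes_tendsto_atBot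
    gumbelStieltjes_tendsto_atTop]
  rfl

/-! The covariance is that of `ρ (x i + x j) + s y (i, j)` with `ρ = √r`, `s = √(1 - 2r)` and all
`x`, `y` independent standard Gaussians (`IsSparseEquicorrelatedField.map_eq`). Given `x`,
exceedances of a level `u` are independent, so the law of the maximum is the `x`-average of `∏ (1 -
q_p)`, where `q_p` is the conditional tail of pair `p` (`pairModelMeasure_real_forall_le`). If every
`q_p ≤ ε`, this product is close to `exp (-∑ q_p)`; it remains to have `ε → 0` and `∑ q_p → λ` in
`L²`, where `λ` is the limiting expected number of exceedances.

To secure both, `q_p` is replaced by zero unless both coordinates are at most `c = c_n`. This costs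
at most `n P(Z > c)`, which tends to `0`. The truncation matters: with no constraint on the shared
coordinate, the Chernoff bound for two overlapping pairs is, up to lower order, `exp (-2c² / (1 +
ρ²))`, which is not `O(n⁻³)` once `ρ² > 1/3`.

Write `u = √2 c - w`, `δ = c (1 - √2 ρ)` and `L = log c`, and recall `exp (c² / 2) = n`. The loss `w
c` is at most `L`. The truncated tails are at most `exp (-√2 δ + w + 1/2)`. Truncation lowers each
mean by at most `2 n⁻² exp (-δ²/2 + 3L)` (`exists_chernoff_exponent_truncated`), over at most `n²`
pairs. Disjoint pairs are independent, and two pairs sharing an index have mixed moment at most `n⁻³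
exp (-δ²/10 + 6L)` (`exists_chernoff_exponent_overlap`), over `O(n³)` such couples. The hypothesis
on `r` makes `δ ≥ 10 L` eventually, so all these errors vanish. Mills' ratio identifies `λ`. -/

/-! ### Independent standard Gaussian coordinates. -/

/-- The law of a family of independent standard Gaussian variables indexed by `ι`. -/
noncomputable abbrev stdGaussianPi (ι : Type*) [Fintype ι] : Measure (ι → ℝ) :=
  Measure.pi fun _ : ι => gaussianReal 0 1

instance stdGaussianPi_isGaussian (ι : Type*) [Fintype ι] : IsGaussian (stdGaussianPi ι) := by
  have h1 : iIndepFun (fun (i : ι) (x : ι → ℝ) => x i) (stdGaussianPi ι) :=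
    iIndepFun_pi (X := fun _ x => x) fun _ => aemeasurable_id
  have h2 : ∀ i : ι, HasGaussianLaw (fun x : ι → ℝ => x i) (stdGaussianPi ι) := fun i => by
    constructor
    rw [(measurePreserving_eval (fun _ : ι => gaussianReal 0 1) i).map_eq]
    infer_instance
  have h := (iIndepFun.hasGaussianLaw h2 h1).isGaussian_map
  rwa [show (fun (ω : ι → ℝ) x => ω x) = id from rfl, Measure.map_id] at h

theorem iIndepFun_stdGaussianPi (ι : Type*) [Fintype ι] :
    iIndepFun (fun (i : ι) (x : ι → ℝ) => x i) (stdGaussianPi ι) :=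
  iIndepFun_pi (X := fun _ x => x) fun _ => aemeasurable_id

theorem stdGaussianPi_map_eval {ι : Type*} [Fintype ι] (i : ι) :
    (stdGaussianPi ι).map (fun x => x i) = gaussianReal 0 1 :=
  (measurePreserving_eval (fun _ : ι => gaussianReal 0 1) i).map_eq

theorem integral_comp_eval_stdGaussianPi {ι : Type*} [Fintype ι] (i : ι) {f : ℝ → ℝ}
    (hf : AEStronglyMeasurable f (gaussianReal 0 1)) :
    ∫ x, f (x i) ∂stdGaussianPi ι = ∫ y, f y ∂gaussianReal 0 1 := by
  rw [← stdGaussianPi_map_eval i] at hf ⊢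
  rw [integral_map (measurable_pi_apply i).aemeasurable hf]

theorem integral_eval_stdGaussianPi {ι : Type*} [Fintype ι] (i : ι) :
    ∫ x, x i ∂stdGaussianPi ι = 0 := by
  rw [integral_comp_eval_stdGaussianPi i (f := fun y => y) (by fun_prop)]
  exact integral_id_gaussianReal

theorem hasGaussianLaw_eval_stdGaussianPi {ι : Type*} [Fintype ι] (i : ι) :
    HasGaussianLaw (fun x : ι → ℝ => x i) (stdGaussianPi ι) := by
  constructor
  rw [stdGaussianPi_map_eval]
  infer_instance

theorem integral_eval_mul_eval_stdGaussianPi {ι : Type*} [Fintype ι] [DecidableEq ι] (i j : ι) :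
    ∫ x, x i * x j ∂stdGaussianPi ι = if i = j then 1 else 0 := by
  split_ifs with h
  · subst h
    rw [integral_comp_eval_stdGaussianPi i (f := fun y => y * y) (by fun_prop)]
    have h1 := variance_of_integral_eq_zero (X := fun y : ℝ => y) (μ := gaussianReal 0 1)
      aemeasurable_id integral_id_gaussianReal
    rw [variance_fun_id_gaussianReal] at h1
    simpa [pow_two] using h1.symm
  · have h1 := ((iIndepFun_stdGaussianPi ι).indepFun h).integral_mul_eq_mul_integral
      (measurable_pi_apply i).aestronglyMeasurable (measurable_pi_apply j).aestronglyMeasurable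
    simpa [integral_eval_stdGaussianPi] using h1

/-! ### Centered Gaussian vectors are determined by second moments. -/

theorem HasGaussianLaw.integral_dual_and_variance_dual {ι Ω : Type*} [Fintype ι] [DecidableEq ι]
    [MeasurableSpace Ω] {P : Measure Ω} {X : ι → Ω → ℝ}
    (hX : HasGaussianLaw (fun ω i => X i ω) P) (h0 : ∀ i, ∫ ω, X i ω ∂P = 0)
    (L : StrongDual ℝ (ι → ℝ)) :
    ∫ ω, L (fun i => X i ω) ∂P = 0 ∧
      Var[fun ω => L (fun i => X i ω); P] =
        ∑ i, ∑ j, L (Pi.single i 1) * L (Pi.single j 1) * ∫ ω, X i ω * X j ω ∂P := by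
  have hP := hX.isProbabilityMeasure
  obtain ⟨l, hl⟩ : ∃ l : ι → ℝ, ∀ i, L (Pi.single i 1) = l i := ⟨_, fun _ => rfl⟩
  have hL : ∀ x : ι → ℝ, L x = ∑ i, l i * x i := fun x => by
    conv_lhs => rw [← Finset.univ_sum_single x, map_sum]
    refine Finset.sum_congr rfl fun i _ => ?_
    have : Pi.single i (x i) = x i • (Pi.single i (1 : ℝ) : ι → ℝ) := by
      rw [← Pi.single_smul]; simp
    rw [this, map_smul, smul_eq_mul, mul_comm, hl]
  have hi : ∀ i, Integrable (X i) P := fun i => (hX.eval i).integrable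
  have hij : ∀ i j, Integrable (fun ω => X i ω * X j ω) P := fun i j =>
    (hX.eval i).memLp_two.integrable_mul (hX.eval j).memLp_two
  have hz : ∫ ω, L (fun i => X i ω) ∂P = 0 := by
    simp only [hL]
    rw [integral_finsetSum _ fun i _ => (hi i).const_mul _]
    simp [integral_const_mul, h0]
  refine ⟨hz, ?_⟩
  rw [variance_of_integral_eq_zero (hX.map_fun L).aemeasurable hz]
  have e : ∀ ω, L (fun i => X i ω) ^ 2 = ∑ i, ∑ j, l i * l j * (X i ω * X j ω) := fun ω => by
    rw [hL, pow_two, Finset.sum_mul_sum]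
    refine Finset.sum_congr rfl fun i _ => Finset.sum_congr rfl fun j _ => ?_
    ring
  simp only [e, hl]
  rw [integral_finsetSum _ fun i _ => integrable_finsetSum _ fun j _ => (hij i j).const_mul _]
  refine Finset.sum_congr rfl fun i _ => ?_
  rw [integral_finsetSum _ fun j _ => (hij i j).const_mul _]
  simp only [integral_const_mul]

/-- Centered Gaussian vectors with the same second moments have the same law. -/
theorem HasGaussianLaw.map_eq_map_of_integral_mul_eq {ι Ω Ω' : Type*} [Fintype ι]
    [MeasurableSpace Ω] [MeasurableSpace Ω'] {P : Measure Ω} {Q : Measure Ω'}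
    {X : ι → Ω → ℝ} {Y : ι → Ω' → ℝ}
    (hX : HasGaussianLaw (fun ω i => X i ω) P) (hY : HasGaussianLaw (fun ω i => Y i ω) Q)
    (hX0 : ∀ i, ∫ ω, X i ω ∂P = 0) (hY0 : ∀ i, ∫ ω, Y i ω ∂Q = 0)
    (hXY : ∀ i j, ∫ ω, X i ω * X j ω ∂P = ∫ ω, Y i ω * Y j ω ∂Q) :
    P.map (fun ω i => X i ω) = Q.map (fun ω i => Y i ω) := by
  classical
  have := hX.isProbabilityMeasure
  have := hY.isProbabilityMeasure
  have := Measure.isFiniteMeasure_map P (fun ω i => X i ω)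
  have := Measure.isFiniteMeasure_map Q (fun ω i => Y i ω)
  refine Measure.ext_of_charFunDual (funext fun L => ?_)
  obtain ⟨a, b⟩ := HasGaussianLaw.integral_dual_and_variance_dual hX hX0 L
  obtain ⟨c, d⟩ := HasGaussianLaw.integral_dual_and_variance_dual hY hY0 L
  rw [hX.charFunDual_map_eq_fun, hY.charFunDual_map_eq_fun, a, b, c, d]
  simp_rw [hXY]

/-! ### Overlaps and the covariance of the field. -/

namespace UpperPair

/-- As a sum of four indicators, the overlap is the covariance of `x i + x j` and `x k + x l` for
independent standard `x`. -/
theorem overlap_eq_sum {n : ℕ} (p q : UpperPair n) :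
    p.overlap q = (if p.1.1 = q.1.1 then 1 else 0) + (if p.1.1 = q.1.2 then 1 else 0)
      + (if p.1.2 = q.1.1 then 1 else 0) + (if p.1.2 = q.1.2 then 1 else 0) := by
  obtain ⟨⟨i, j⟩, hij⟩ := p
  obtain ⟨⟨k, l⟩, hkl⟩ := q
  simp only [overlap, support] at *
  have h1 : i ≠ j := hij.ne
  have h2 : k ≠ l := hkl.ne
  rw [← Finset.filter_mem_eq_inter, Finset.card_filter, Finset.sum_pair h1]
  simp only [Finset.mem_insert, Finset.mem_singleton]
  split_ifs <;> simp_all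

theorem overlap_self {n : ℕ} (p : UpperPair n) : p.overlap p = 2 := by
  simp [overlap, support, Finset.card_pair p.2.ne]

theorem overlap_le_one_of_ne {n : ℕ} {p q : UpperPair n} (h : p ≠ q) : p.overlap q ≤ 1 := by
  rw [overlap_eq_sum]
  obtain ⟨⟨i, j⟩, hij⟩ := p
  obtain ⟨⟨k, l⟩, hkl⟩ := q
  simp only [ne_eq, Subtype.mk.injEq, Prod.mk.injEq, not_and] at *
  split_ifs <;> first | omega | simp_all
  all_goals (subst_vars; first | exact absurd rfl (h rfl) | exact absurd hij (lt_asymm hkl))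

end UpperPair

/-- The three cases merge into one affine expression, the shape the model produces; on the diagonal
`2r + (1 - 2r) = 1`. -/
theorem IsSparseEquicorrelatedField.integral_mul {Ω : Type*} [MeasurableSpace Ω] {n : ℕ} {r : ℝ}
    {G : UpperPair n → Ω → ℝ} {P : Measure Ω} (hG : IsSparseEquicorrelatedField n r G P)
    (p q : UpperPair n) :
    ∫ ω, G p ω * G q ω ∂P = r * p.overlap q + (1 - 2 * r) * if p = q then 1 else 0 := by
  by_cases h : p = q
  · subst h
    rw [hG.cov_two p p p.overlap_self, p.overlap_self]
    simp
    ring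
  · have := UpperPair.overlap_le_one_of_ne h
    rcases Nat.le_one_iff_eq_zero_or_eq_one.1 this with h1 | h1
    · rw [hG.cov_zero p q h1, h1]; simp [h]
    · rw [hG.cov_one p q h1, h1]; simp [h]

/-! ### The model field and its law. -/

/-- The field `ρ (x i + x j) + s y (i, j)` built from independent standard Gaussian variables. -/
def pairModel {n : ℕ} (ρ s : ℝ) (p : UpperPair n) (z : (Fin n → ℝ) × (UpperPair n → ℝ)) : ℝ :=
  ρ * (z.1 p.1.1 + z.1 p.1.2) + s * z.2 p

/-- The product space carrying `pairModel`. -/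
noncomputable abbrev pairModelMeasure (n : ℕ) : Measure ((Fin n → ℝ) × (UpperPair n → ℝ)) :=
  (stdGaussianPi (Fin n)).prod (stdGaussianPi (UpperPair n))

theorem hasGaussianLaw_pairModel (n : ℕ) (ρ s : ℝ) :
    HasGaussianLaw (fun z (p : UpperPair n) => pairModel ρ s p z) (pairModelMeasure n) := by
  have h : HasGaussianLaw (fun z => z) (pairModelMeasure n) := IsGaussian.hasGaussianLaw_id
  let L : ((Fin n → ℝ) × (UpperPair n → ℝ)) →ₗ[ℝ] (UpperPair n → ℝ) :=
    { toFun := fun z p => pairModel ρ s p z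
      map_add' := fun x y => by ext p; simp [pairModel]; ring
      map_smul' := fun a x => by ext p; simp [pairModel]; ring }
  exact h.map_fun (LinearMap.toContinuousLinearMap L)

theorem integral_pairModel {n : ℕ} (ρ s : ℝ) (p : UpperPair n) :
    ∫ z, pairModel ρ s p z ∂pairModelMeasure n = 0 := by
  have hx : ∀ i, Integrable (fun x : Fin n → ℝ => x i) (stdGaussianPi (Fin n)) := fun i =>
    (hasGaussianLaw_eval_stdGaussianPi i).integrable
  have hy : Integrable (fun y : UpperPair n → ℝ => y p) (stdGaussianPi (UpperPair n)) :=
    (hasGaussianLaw_eval_stdGaussianPi p).integrable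
  simp only [pairModel]
  rw [integral_add, integral_const_mul, integral_const_mul, integral_add]
  · rw [integral_fun_fst (fun x : Fin n → ℝ => x p.1.1),
      integral_fun_fst (fun x : Fin n → ℝ => x p.1.2),
      integral_fun_snd (fun y : UpperPair n → ℝ => y p)]
    simp [integral_eval_stdGaussianPi]
  · exact (hx _).comp_fst _
  · exact (hx _).comp_fst _
  · exact (((hx _).comp_fst _).add ((hx _).comp_fst _)).const_mul _
  · exact (hy.comp_snd _).const_mul _

theorem integral_pairModel_mul {n : ℕ} (ρ s : ℝ) (p q : UpperPair n) :
    ∫ z, pairModel ρ s p z * pairModel ρ s q z ∂pairModelMeasure n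
      = ρ ^ 2 * p.overlap q + s ^ 2 * if p = q then 1 else 0 := by
  have hx2 : ∀ i, MemLp (fun x : Fin n → ℝ => x i) 2 (stdGaussianPi (Fin n)) := fun i =>
    (hasGaussianLaw_eval_stdGaussianPi i).memLp_two
  have hy2 : ∀ p, MemLp (fun y : UpperPair n → ℝ => y p) 2 (stdGaussianPi (UpperPair n)) :=
    fun p => (hasGaussianLaw_eval_stdGaussianPi p).memLp_two
  have hxx : ∀ i j, Integrable (fun z : (Fin n → ℝ) × (UpperPair n → ℝ) => z.1 i * z.1 j)
      (pairModelMeasure n) := fun i j => ((hx2 i).integrable_mul (hx2 j)).comp_fst _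
  have hyy : Integrable (fun z : (Fin n → ℝ) × (UpperPair n → ℝ) => z.2 p * z.2 q)
      (pairModelMeasure n) := ((hy2 p).integrable_mul (hy2 q)).comp_snd _
  have hxy : ∀ i p, Integrable (fun z : (Fin n → ℝ) × (UpperPair n → ℝ) => z.1 i * z.2 p)
      (pairModelMeasure n) := fun i p =>
    ((hx2 i).integrable one_le_two).mul_prod ((hy2 p).integrable one_le_two)
  have ixx : ∀ i j, ∫ z, z.1 i * z.1 j ∂(pairModelMeasure n) = if i = j then 1 else 0 :=
    fun i j => by
      rw [integral_fun_fst (fun x : Fin n → ℝ => x i * x j)]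
      simp [integral_eval_mul_eval_stdGaussianPi]
  have iyy : ∫ z, z.2 p * z.2 q ∂(pairModelMeasure n) = if p = q then 1 else 0 := by
    rw [integral_fun_snd (fun x : UpperPair n → ℝ => x p * x q)]
    simp [integral_eval_mul_eval_stdGaussianPi]
  have ixy : ∀ i p, ∫ z, z.1 i * z.2 p ∂(pairModelMeasure n) = 0 := fun i p => by
    rw [integral_prod_mul (fun x : Fin n → ℝ => x i) (fun y : UpperPair n → ℝ => y p)]
    simp [integral_eval_stdGaussianPi]
  obtain ⟨⟨i, j⟩, hij⟩ := p
  obtain ⟨⟨k, l⟩, hkl⟩ := q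
  set p : UpperPair n := ⟨⟨i, j⟩, hij⟩
  set q : UpperPair n := ⟨⟨k, l⟩, hkl⟩
  have h1 : Integrable (fun z : (Fin n → ℝ) × (UpperPair n → ℝ) =>
      z.1 i * z.1 k + z.1 i * z.1 l + z.1 j * z.1 k + z.1 j * z.1 l) (pairModelMeasure n) :=
    (((hxx i k).add (hxx i l)).add (hxx j k)).add (hxx j l)
  have h2 : Integrable (fun z : (Fin n → ℝ) × (UpperPair n → ℝ) =>
      z.1 i * z.2 q + z.1 j * z.2 q + z.1 k * z.2 p + z.1 l * z.2 p) (pairModelMeasure n) :=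
    (((hxy i q).add (hxy j q)).add (hxy k p)).add (hxy l p)
  have e : ∀ z : (Fin n → ℝ) × (UpperPair n → ℝ),
      pairModel ρ s p z * pairModel ρ s q z =
      ρ ^ 2 * (z.1 i * z.1 k + z.1 i * z.1 l + z.1 j * z.1 k + z.1 j * z.1 l)
      + ρ * s * (z.1 i * z.2 q + z.1 j * z.2 q + z.1 k * z.2 p + z.1 l * z.2 p)
      + s ^ 2 * (z.2 p * z.2 q) := fun z => by simp only [pairModel, p, q]; ring
  simp_rw [e]
  have h12 := (h1.const_mul (ρ ^ 2)).add (h2.const_mul (ρ * s))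
  have hx3 := (hxx i k).add (hxx i l)
  have hx4 := hx3.add (hxx j k)
  have hy3 := (hxy i q).add (hxy j q)
  have hy4 := hy3.add (hxy k p)
  simp only [Pi.add_def] at h12 hx3 hx4 hy3 hy4
  rw [integral_add h12 (hyy.const_mul _),
    integral_add (h1.const_mul _) (h2.const_mul _), integral_const_mul, integral_const_mul,
    integral_const_mul,
    integral_add hx4 (hxx j l), integral_add hx3 (hxx j k), integral_add (hxx i k) (hxx i l),
    integral_add hy4 (hxy l p), integral_add hy3 (hxy k p), integral_add (hxy i q) (hxy j q),
    iyy, UpperPair.overlap_eq_sum]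
  simp only [ixx, ixy]
  push_cast
  ring

theorem IsSparseEquicorrelatedField.map_eq {Ω : Type*} [MeasurableSpace Ω] {n : ℕ} {r : ℝ}
    {G : UpperPair n → Ω → ℝ} {P : Measure Ω} (hG : IsSparseEquicorrelatedField n r G P)
    (hr : r ∈ Set.Icc (0 : ℝ) (1 / 2)) :
    P.map (fun ω p => G p ω) =
      (pairModelMeasure n).map (fun z p => pairModel √r √(1 - 2 * r) p z) := by
  have h1 : HasGaussianLaw (fun ω p => G p ω) P := by
    have h := hG.isGaussianProcess.hasGaussianLaw (Finset.univ : Finset (UpperPair n))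
    let L : (((Finset.univ : Finset (UpperPair n)) : Type) → ℝ) →ₗ[ℝ] (UpperPair n → ℝ) :=
      { toFun := fun z p => z ⟨p, Finset.mem_univ p⟩
        map_add' := fun x y => rfl
        map_smul' := fun a x => rfl }
    exact h.map_fun (LinearMap.toContinuousLinearMap L)
  refine HasGaussianLaw.map_eq_map_of_integral_mul_eq h1 (hasGaussianLaw_pairModel n _ _)
    hG.centered (integral_pairModel _ _) fun p q => ?_
  rw [hG.integral_mul, integral_pairModel_mul, Real.sq_sqrt hr.1, Real.sq_sqrt (by linarith [hr.2])]

/-! ### Conditional tails. -/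

/-- The conditional probability that `ρ a + s Z` exceeds `u`, where `Z` is standard Gaussian. -/
noncomputable def shiftedTail (ρ s u a : ℝ) : ℝ :=
  (gaussianReal 0 1).real {z | u < ρ * a + s * z}

theorem shiftedTail_nonneg (ρ s u a : ℝ) : 0 ≤ shiftedTail ρ s u a := measureReal_nonneg

theorem shiftedTail_le_one (ρ s u a : ℝ) : shiftedTail ρ s u a ≤ 1 := measureReal_le_one

theorem measurable_shiftedTail (ρ s u : ℝ) : Measurable (shiftedTail ρ s u) := by
  have h : MeasurableSet {x : ℝ × ℝ | u < ρ * x.1 + s * x.2} :=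
    measurableSet_lt (by fun_prop) (by fun_prop)
  exact (measurable_measure_prodMk_left (ν := gaussianReal 0 1) h).ennreal_toReal

/-- Chernoff's bound; `α` stays free so that it can be optimised after averaging over `x`. -/
theorem shiftedTail_le_exp {α : ℝ} (hα : 0 ≤ α) (ρ s u a : ℝ) :
    shiftedTail ρ s u a ≤ Real.exp (α * (ρ * a - u) + α ^ 2 * s ^ 2 / 2) := by
  have h1 := measure_ge_le_exp_mul_mgf (μ := gaussianReal 0 1) (X := fun z => s * z) (u - ρ * a) hα
    (by simpa [mul_assoc] using integrable_exp_mul_gaussianReal (μ := 0) (v := 1) (α * s))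
  have h2 : mgf (fun z : ℝ => s * z) (gaussianReal 0 1) α = Real.exp (α ^ 2 * s ^ 2 / 2) := by
    rw [mgf_const_mul, mgf_gaussianReal (μ := 0) (v := 1) (X := fun z => z) Measure.map_id]
    congr 1
    push_cast
    ring
  rw [h2, ← Real.exp_add] at h1
  refine le_trans (measureReal_mono fun z hz => ?_) (h1.trans_eq ?_)
  · simp only [Set.mem_ofPred_eq] at hz ⊢
    linarith
  · congr 1
    ring

theorem one_sub_shiftedTail (ρ s u a : ℝ) :
    1 - shiftedTail ρ s u a = (gaussianReal 0 1).real {z | ρ * a + s * z ≤ u} := by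
  have h : MeasurableSet {z : ℝ | u < ρ * a + s * z} :=
    measurableSet_lt (by fun_prop) (by fun_prop)
  rw [shiftedTail, ← probReal_compl_eq_one_sub h]
  congr with z
  simp

/-- Fubini: for fixed `x` the event is a box in `y`, so its probability factorises. -/
theorem pairModelMeasure_real_forall_le (n : ℕ) (ρ s u : ℝ) :
    (pairModelMeasure n).real {z | ∀ p, pairModel ρ s p z ≤ u} =
      ∫ x, ∏ p : UpperPair n, (1 - shiftedTail ρ s u (x p.1.1 + x p.1.2))
        ∂stdGaussianPi (Fin n) := by
  have hm : MeasurableSet {z : (Fin n → ℝ) × (UpperPair n → ℝ) | ∀ p, pairModel ρ s p z ≤ u} := by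
    simp only [Set.ofPred_forall, pairModel]
    refine MeasurableSet.iInter fun p => measurableSet_le (by fun_prop) (by fun_prop)
  rw [measureReal_def, Measure.prod_apply hm, ← integral_toReal]
  · refine integral_congr_ae (ae_of_all _ fun x => ?_)
    have h : Prod.mk x ⁻¹' {z : (Fin n → ℝ) × (UpperPair n → ℝ) | ∀ p, pairModel ρ s p z ≤ u} =
        Set.univ.pi fun p : UpperPair n => {y : ℝ | ρ * (x p.1.1 + x p.1.2) + s * y ≤ u} := by
      ext y
      simp [pairModel]
    simp only [h, one_sub_shiftedTail, Measure.pi_pi, ENNReal.toReal_prod, measureReal_def]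
  · exact (measurable_measure_prodMk_left hm).aemeasurable
  · exact ae_of_all _ fun x => measure_lt_top _ _

theorem pairModelMeasure_real_lt (n : ℕ) (ρ s u : ℝ) (p : UpperPair n) :
    (pairModelMeasure n).real {z | u < pairModel ρ s p z} =
      ∫ x, shiftedTail ρ s u (x p.1.1 + x p.1.2) ∂stdGaussianPi (Fin n) := by
  have hm : MeasurableSet {z : (Fin n → ℝ) × (UpperPair n → ℝ) | u < pairModel ρ s p z} := by
    simp only [pairModel]
    exact measurableSet_lt (by fun_prop) (by fun_prop)
  rw [measureReal_def, Measure.prod_apply hm, ← integral_toReal]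
  · refine integral_congr_ae (ae_of_all _ fun x => ?_)
    have hm' : MeasurableSet {y : ℝ | u < ρ * (x p.1.1 + x p.1.2) + s * y} :=
      measurableSet_lt (by fun_prop) (by fun_prop)
    simp only [shiftedTail, measureReal_def]
    rw [← stdGaussianPi_map_eval p, Measure.map_apply (by fun_prop) hm']
    rfl
  · exact (measurable_measure_prodMk_left hm).aemeasurable
  · exact ae_of_all _ fun x => measure_lt_top _ _

/-- Averaging over `x` restores the unconditional tail, and the model variable has variance `2ρ² +
s² = 1`. -/
theorem integral_shiftedTail {n : ℕ} {ρ s : ℝ} (h : 2 * ρ ^ 2 + s ^ 2 = 1) (u : ℝ)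
    (p : UpperPair n) :
    ∫ x, shiftedTail ρ s u (x p.1.1 + x p.1.2) ∂stdGaussianPi (Fin n) =
      (gaussianReal 0 1).real (Set.Ioi u) := by
  have hg := (hasGaussianLaw_pairModel n ρ s).eval p
  have hv : Var[pairModel ρ s p; pairModelMeasure n] = 1 := by
    rw [variance_of_integral_eq_zero hg.aemeasurable (integral_pairModel ρ s p)]
    simp_rw [pow_two]
    rw [integral_pairModel_mul, p.overlap_self]
    simp only [if_true]
    push_cast
    linarith
  have hl := hg.map_eq_gaussianReal
  rw [hv, integral_pairModel, Real.toNNReal_one] at hl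
  rw [← pairModelMeasure_real_lt, ← hl, measureReal_def, measureReal_def,
    Measure.map_apply_of_aemeasurable hg.aemeasurable measurableSet_Ioi]
  rfl

/-! ### Exponential moments and truncated tails. -/

theorem exp_sum_stdGaussianPi {ι : Type*} [Fintype ι] (t : Finset ι) (a : ι → ℝ) :
    Integrable (fun x => Real.exp (∑ k ∈ t, a k * x k)) (stdGaussianPi ι) ∧
      ∫ x, Real.exp (∑ k ∈ t, a k * x k) ∂stdGaussianPi ι = Real.exp ((∑ k ∈ t, a k ^ 2) / 2) := by
  classical
  have e : ∀ x : ι → ℝ, Real.exp (∑ k ∈ t, a k * x k) =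
      ∏ k, Real.exp ((if k ∈ t then a k else 0) * x k) := fun x => by
    rw [← Real.exp_sum]
    simp [ite_mul, Finset.sum_ite_mem]
  have h1 : ∀ b : ℝ, ∫ y, Real.exp (b * y) ∂gaussianReal 0 1 = Real.exp (b ^ 2 / 2) := fun b => by
    have := mgf_gaussianReal (p := gaussianReal 0 1) (X := fun y => y) Measure.map_id b
    rw [mgf] at this
    rw [this]
    simp
  simp_rw [e]
  refine ⟨Integrable.fintype_prod (f := fun k y => Real.exp ((if k ∈ t then a k else 0) * y))
    fun k => integrable_exp_mul_gaussianReal _, ?_⟩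
  rw [integral_fintype_prod_eq_prod (fun k y => Real.exp ((if k ∈ t then a k else 0) * y))]
  simp_rw [h1, ← Real.exp_sum, Finset.sum_div]
  simp [ite_pow, ite_div, Finset.sum_ite_mem]

theorem exp_add_stdGaussianPi {ι : Type*} [Fintype ι] {i j : ι} (hij : i ≠ j) (a b : ℝ) :
    Integrable (fun x => Real.exp (a * x i + b * x j)) (stdGaussianPi ι) ∧
      ∫ x, Real.exp (a * x i + b * x j) ∂stdGaussianPi ι = Real.exp ((a ^ 2 + b ^ 2) / 2) := by
  classical
  have h := exp_sum_stdGaussianPi {i, j} (fun k => if k = i then a else b)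
  simpa [Finset.sum_pair hij, hij.symm] using h

theorem exp_add_add_stdGaussianPi {ι : Type*} [Fintype ι] {i j k : ι} (hij : i ≠ j) (hik : i ≠ k)
    (hjk : j ≠ k) (a b c : ℝ) :
    Integrable (fun x => Real.exp (a * x i + b * x j + c * x k)) (stdGaussianPi ι) ∧
      ∫ x, Real.exp (a * x i + b * x j + c * x k) ∂stdGaussianPi ι =
        Real.exp ((a ^ 2 + b ^ 2 + c ^ 2) / 2) := by
  classical
  have h := exp_sum_stdGaussianPi {i, j, k} (fun l => if l = i then a else if l = j then b else c)
  simpa [Finset.sum_insert, hij, hik, hjk, hij.symm, hik.symm, hjk.symm, add_assoc] using h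

/-- The conditional tail probability, truncated to both coordinates being at most `c`. -/
noncomputable def truncTail (ρ s u c x y : ℝ) : ℝ :=
  if x ≤ c ∧ y ≤ c then shiftedTail ρ s u (x + y) else 0

theorem truncTail_nonneg (ρ s u c x y : ℝ) : 0 ≤ truncTail ρ s u c x y := by
  unfold truncTail; split_ifs
  exacts [shiftedTail_nonneg .., le_rfl]

theorem truncTail_le_shiftedTail (ρ s u c x y : ℝ) :
    truncTail ρ s u c x y ≤ shiftedTail ρ s u (x + y) := by
  unfold truncTail; split_ifs
  exacts [le_rfl, shiftedTail_nonneg ..]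

theorem truncTail_comm (ρ s u c x y : ℝ) : truncTail ρ s u c x y = truncTail ρ s u c y x := by
  simp only [truncTail, and_comm, add_comm]

theorem measurable_truncTail (ρ s u c : ℝ) :
    Measurable fun z : ℝ × ℝ => truncTail ρ s u c z.1 z.2 := by
  have h := measurable_shiftedTail ρ s u
  refine Measurable.ite ?_ (h.comp (measurable_fst.add measurable_snd)) measurable_const
  exact (measurableSet_le measurable_fst measurable_const).inter
    (measurableSet_le measurable_snd measurable_const)

theorem measurable_truncTail_eval {ι : Type*} (ρ s u c : ℝ) (i j : ι) :
    Measurable fun x : ι → ℝ => truncTail ρ s u c (x i) (x j) := by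
  have h : Measurable fun x : ι → ℝ => (x i, x j) := by fun_prop
  exact (measurable_truncTail ρ s u c).comp h

/-- Chernoff with `α = 1` already suffices for the uniform smallness needed in the Poisson
approximation. -/
theorem truncTail_le_exp {ρ s : ℝ} (hρ : 0 ≤ ρ) (hs : s ^ 2 ≤ 1) (u c x y : ℝ) :
    truncTail ρ s u c x y ≤ Real.exp (2 * ρ * c - u + 1 / 2) := by
  unfold truncTail; split_ifs with h
  · refine (shiftedTail_le_exp zero_le_one ρ s u (x + y)).trans (Real.exp_le_exp.2 ?_)
    nlinarith [mul_le_mul_of_nonneg_left (add_le_add h.1 h.2) hρ]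
  · positivity

/-- The constraint `x i ≤ c` on the shared coordinate is relaxed to the factor `exp (β (c - x i))`;
with Chernoff for both tails this leaves an explicit Gaussian integral. The constraints on the other
coordinates are dropped. -/
theorem integral_truncTail_mul_le {ι : Type*} [Fintype ι] {i j k : ι} (hij : i ≠ j) (hik : i ≠ k)
    (hjk : j ≠ k) {ρ s : ℝ} (h : 2 * ρ ^ 2 + s ^ 2 = 1) (u c : ℝ) {α β : ℝ} (hα : 0 ≤ α)
    (hβ : 0 ≤ β) :
    ∫ x, truncTail ρ s u c (x i) (x j) * truncTail ρ s u c (x i) (x k) ∂stdGaussianPi ι ≤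
      Real.exp (β * c - 2 * α * u + (2 * α * ρ - β) ^ 2 / 2 + α ^ 2 * (1 - ρ ^ 2)) := by
  obtain ⟨h1, h2⟩ := exp_add_add_stdGaussianPi hij hik hjk (2 * α * ρ - β) (α * ρ) (α * ρ)
  have hle : ∀ x : ι → ℝ, truncTail ρ s u c (x i) (x j) * truncTail ρ s u c (x i) (x k) ≤
      Real.exp (β * c - 2 * α * u + α ^ 2 * s ^ 2) *
        Real.exp ((2 * α * ρ - β) * x i + α * ρ * x j + α * ρ * x k) := fun x => by
    by_cases hx : x i ≤ c
    · calc _ ≤ shiftedTail ρ s u (x i + x j) * shiftedTail ρ s u (x i + x k) :=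
            mul_le_mul (truncTail_le_shiftedTail ..) (truncTail_le_shiftedTail ..)
              (truncTail_nonneg ..) (shiftedTail_nonneg ..)
        _ ≤ _ := mul_le_mul (shiftedTail_le_exp hα ..) (shiftedTail_le_exp hα ..)
              (shiftedTail_nonneg ..) (Real.exp_nonneg _)
        _ ≤ _ := by
          rw [← Real.exp_add, ← Real.exp_add, Real.exp_le_exp]
          nlinarith [mul_le_mul_of_nonneg_left hx hβ]
    · rw [truncTail, if_neg (fun h => hx h.1), zero_mul]
      positivity
  refine (integral_mono_of_nonneg (ae_of_all _ fun x => mul_nonneg (truncTail_nonneg ..)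
    (truncTail_nonneg ..)) (h1.const_mul _) (ae_of_all _ hle)).trans_eq ?_
  rw [integral_const_mul, h2, ← Real.exp_add]
  congr 1
  have : s ^ 2 = 1 - 2 * ρ ^ 2 := by linarith
  rw [this]
  ring

/-- Same relaxation with the opposite sign: the indicator of `c < x i` is at most `exp (β (x i -
c))`. -/
theorem integral_shiftedTail_indicator_le {ι : Type*} [Fintype ι] {i j : ι} (hij : i ≠ j)
    {ρ s : ℝ} (h : 2 * ρ ^ 2 + s ^ 2 = 1) (u c : ℝ) {α β : ℝ} (hα : 0 ≤ α) (hβ : 0 ≤ β) :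
    ∫ x, (if c < x i then shiftedTail ρ s u (x i + x j) else 0) ∂stdGaussianPi ι ≤
      Real.exp (-α * u - β * c + ((α * ρ + β) ^ 2 + α ^ 2 * (1 - ρ ^ 2)) / 2) := by
  obtain ⟨h1, h2⟩ := exp_add_stdGaussianPi hij (α * ρ + β) (α * ρ)
  have hle : ∀ x : ι → ℝ, (if c < x i then shiftedTail ρ s u (x i + x j) else 0) ≤
      Real.exp (-α * u - β * c + α ^ 2 * s ^ 2 / 2) *
        Real.exp ((α * ρ + β) * x i + α * ρ * x j) := fun x => by
    split_ifs with hx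
    · refine (shiftedTail_le_exp hα ..).trans ?_
      rw [← Real.exp_add, Real.exp_le_exp]
      nlinarith [mul_le_mul_of_nonneg_left hx.le hβ]
    · positivity
  have h0 : ∀ x : ι → ℝ, 0 ≤ if c < x i then shiftedTail ρ s u (x i + x j) else 0 := fun x => by
    split_ifs
    exacts [shiftedTail_nonneg .., le_rfl]
  refine (integral_mono_of_nonneg (ae_of_all _ h0) (h1.const_mul _) (ae_of_all _ hle)).trans_eq ?_
  rw [integral_const_mul, h2, ← Real.exp_add]
  congr 1
  have : s ^ 2 = 1 - 2 * ρ ^ 2 := by linarith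
  rw [this]
  ring

/-! ### Poisson approximation of a product of small-probability factors. -/

/-- For `0 ≤ q ≤ ε ≤ 1/2` one has `exp (-q - 2εq) ≤ 1 - q ≤ exp (-q)`, which traps the product near
`exp (-∑ q)`; then `exp (-·)` is 1-Lipschitz on `[0, ∞)`. -/
theorem abs_prod_one_sub_sub_exp_neg_le {ι : Type*} [Fintype ι] {q : ι → ℝ} {ε lam : ℝ}
    (h0 : ∀ i, 0 ≤ q i) (hε : ∀ i, q i ≤ ε) (hε' : ε ≤ 1 / 2) (hl : 0 ≤ lam) :
    |∏ i, (1 - q i) - Real.exp (-lam)| ≤ 2 * ε * ∑ i, q i + |∑ i, q i - lam| := by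
  set S := ∑ i, q i with hS
  have hS0 : 0 ≤ S := Finset.sum_nonneg fun i _ => h0 i
  have hup : ∏ i, (1 - q i) ≤ Real.exp (-S) := by
    rw [hS, ← Finset.sum_neg_distrib, Real.exp_sum]
    refine Finset.prod_le_prod (fun i _ => by linarith [hε i]) fun i _ => ?_
    linarith [Real.add_one_le_exp (-q i)]
  have hlow : Real.exp (-S) - 2 * ε * S ≤ ∏ i, (1 - q i) := by
    have h1 : Real.exp (-(S + 2 * ε * S)) ≤ ∏ i, (1 - q i) := by
      rw [hS, Finset.mul_sum, ← Finset.sum_add_distrib, ← Finset.sum_neg_distrib, Real.exp_sum]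
      refine Finset.prod_le_prod (fun i _ => by positivity) fun i _ => ?_
      have hq := h0 i
      have hq' := hε i
      have h2 : 0 < 1 - q i := by linarith
      rw [Real.exp_neg, inv_le_comm₀ (Real.exp_pos _) h2]
      refine le_trans ?_ (Real.add_one_le_exp _)
      rw [inv_le_iff_one_le_mul₀ h2]
      -- The claim is `(1 - q)(1 + q + 2εq) ≥ 1`, that is `q (2ε - q - 2εq) ≥ 0`, from `q ≤ ε` and
      -- `2εq ≤ ε`.
      nlinarith [mul_nonneg hq (sub_nonneg.2 hq'), mul_nonneg hq (sub_nonneg.2 hε'),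
        mul_nonneg (mul_nonneg hq (sub_nonneg.2 hq')) (sub_nonneg.2 (hq'.trans hε')),
        mul_nonneg hq hq]
    have h2 : Real.exp (-S) - 2 * ε * S ≤ Real.exp (-(S + 2 * ε * S)) := by
      -- The sign of `ε` is known only when there is an index to compare with.
      rcases isEmpty_or_nonempty ι with hι | ⟨⟨i⟩⟩
      · simp [hS]
      have hε0 : 0 ≤ ε := (h0 i).trans (hε i)
      rw [neg_add, Real.exp_add]
      have h3 := Real.add_one_le_exp (-(2 * ε * S))
      have h4 : Real.exp (-S) ≤ 1 := Real.exp_le_one_iff.2 (by linarith)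
      have h5 : 0 ≤ 2 * ε * S := by positivity
      nlinarith [Real.exp_pos (-S), mul_le_mul_of_nonneg_left h3 (Real.exp_pos (-S)).le]
    exact h2.trans h1
  have hLip : |Real.exp (-S) - Real.exp (-lam)| ≤ |S - lam| := by
    have key : ∀ a b : ℝ, 0 ≤ a → a ≤ b → |Real.exp (-a) - Real.exp (-b)| ≤ |a - b| := by
      intro a b ha hab
      have h1 : Real.exp (-b) ≤ Real.exp (-a) := Real.exp_le_exp.2 (by linarith)
      rw [abs_of_nonneg (by linarith), abs_of_nonpos (by linarith)]
      have h2 : Real.exp (-b) = Real.exp (-a) * Real.exp (a - b) := by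
        rw [← Real.exp_add]; congr 1; ring
      have h3 := Real.add_one_le_exp (a - b)
      have h4 : Real.exp (-a) ≤ 1 := Real.exp_le_one_iff.2 (by linarith)
      rw [h2]
      nlinarith [Real.exp_pos (-a), mul_le_mul_of_nonneg_left h3 (Real.exp_pos (-a)).le]
    rcases le_total S lam with h | h
    · exact key _ _ hS0 h
    · rw [abs_sub_comm, abs_sub_comm S]
      exact key _ _ hl h
  rw [abs_le] at hLip ⊢
  have : 0 ≤ 2 * ε * S := by linarith
  constructor <;> linarith

/-- The variance of `|f|` is nonnegative. -/
theorem integral_abs_le_sqrt_integral_sq {Ω : Type*} [MeasurableSpace Ω] {μ : Measure Ω}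
    [IsProbabilityMeasure μ] {f : Ω → ℝ} (hf : MemLp f 2 μ) :
    ∫ x, |f x| ∂μ ≤ √(∫ x, f x ^ 2 ∂μ) := by
  refine Real.le_sqrt_of_sq_le ?_
  have h := variance_nonneg (fun x => |f x|) μ
  rw [variance_eq_sub (by simpa using hf.norm)] at h
  simp only [Pi.pow_apply, sq_abs] at h
  linarith

theorem abs_integral_prod_one_sub_sub_exp_neg_le {Ω ι : Type*} [Fintype ι] [MeasurableSpace Ω]
    {μ : Measure Ω} [IsProbabilityMeasure μ] {q : ι → Ω → ℝ} {ε lam : ℝ}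
    (hm : ∀ i, Measurable (q i)) (h0 : ∀ i x, 0 ≤ q i x) (hε : ∀ i x, q i x ≤ ε)
    (hε' : ε ≤ 1 / 2) (hl : 0 ≤ lam) :
    |∫ x, ∏ i, (1 - q i x) ∂μ - Real.exp (-lam)| ≤
      2 * ε * ∫ x, ∑ i, q i x ∂μ + √(∫ x, (∑ i, q i x - lam) ^ 2 ∂μ) := by
  have hLp : ∀ i, MemLp (q i) 2 μ := fun i =>
    MemLp.of_bound (hm i).aestronglyMeasurable ε (ae_of_all _ fun x => by
      rw [Real.norm_eq_abs, abs_of_nonneg (h0 i x)]; exact hε i x)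
  have hS : MemLp (fun x => ∑ i, q i x) 2 μ := memLp_finsetSum _ fun i _ => hLp i
  have hSl : MemLp (fun x => ∑ i, q i x - lam) 2 μ := hS.sub (memLp_const _)
  have hprod : Integrable (fun x => ∏ i, (1 - q i x)) μ := by
    refine Integrable.of_bound (C := 1) (Measurable.aestronglyMeasurable (by fun_prop))
      (ae_of_all _ fun x => ?_)
    rw [Real.norm_eq_abs, Finset.abs_prod]
    refine Finset.prod_le_one (fun i _ => abs_nonneg _) fun i _ => ?_
    rw [abs_le]
    constructor <;> linarith [h0 i x, hε i x]
  have h1 : ∫ x, ∏ i, (1 - q i x) ∂μ - Real.exp (-lam) =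
      ∫ x, (∏ i, (1 - q i x) - Real.exp (-lam)) ∂μ := by
    rw [integral_sub hprod (integrable_const _)]
    simp
  rw [h1]
  refine (abs_integral_le_integral_abs).trans ?_
  refine le_trans (integral_mono (hprod.sub (integrable_const _)).abs
    (((hS.integrable one_le_two).const_mul (2 * ε)).add (hSl.integrable one_le_two).abs)
    fun x => abs_prod_one_sub_sub_exp_neg_le (fun i => h0 i x) (fun i => hε i x) hε' hl) ?_
  rw [integral_add' ((hS.integrable one_le_two).const_mul (2 * ε)) (hSl.integrable one_le_two).abs,
    integral_const_mul]
  gcongr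
  exact integral_abs_le_sqrt_integral_sq hSl

/-! ### Counting pairs and overlapping couples. -/

namespace UpperPair

theorem two_mul_card (n : ℕ) : (2 * Fintype.card (UpperPair n) : ℝ) = n * (n - 1) := by
  have h : Fintype.card (UpperPair n) = ∑ i ∈ Finset.range n, (n - 1 - i) := by
    rw [Fintype.card_subtype, Finset.card_filter, ← Finset.univ_product_univ, Finset.sum_product,
      Finset.sum_range]
    refine Finset.sum_congr rfl fun i _ => ?_
    rw [← Finset.card_filter, Finset.filter_lt_eq_Ioi, Fin.card_Ioi]
  rw [h, Finset.sum_range_reflect (fun j => j) n]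
  rcases n with _ | m
  · simp
  have h2 := Finset.sum_range_id_mul_two (m + 1)
  have h3 : ((∑ i ∈ Finset.range (m + 1), i : ℕ) : ℝ) * 2 = ((m + 1 : ℕ) : ℝ) * (m : ℝ) := by
    exact_mod_cast h2
  push_cast at h3 ⊢
  linarith

theorem card_filter_fst_eq_le {n : ℕ} (i : Fin n) :
    (Finset.univ.filter fun p : UpperPair n => i = p.1.1).card ≤ n := by
  refine (Finset.card_le_card_of_injOn (fun p => p.1.2) (fun _ _ => Finset.mem_univ _) ?_).trans_eq
    (Finset.card_fin n)
  intro p hp q hq h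
  simp only [Finset.coe_filter, Finset.mem_univ, true_and, Set.mem_ofPred_eq] at hp hq
  exact Subtype.ext (Prod.ext (hp.symm.trans hq) h)

theorem card_filter_snd_eq_le {n : ℕ} (i : Fin n) :
    (Finset.univ.filter fun p : UpperPair n => i = p.1.2).card ≤ n := by
  refine (Finset.card_le_card_of_injOn (fun p => p.1.1) (fun _ _ => Finset.mem_univ _) ?_).trans_eq
    (Finset.card_fin n)
  intro p hp q hq h
  simp only [Finset.coe_filter, Finset.mem_univ, true_and, Set.mem_ofPred_eq] at hp hq
  exact Subtype.ext (Prod.ext h (hp.symm.trans hq))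

theorem sum_overlap_le {n : ℕ} (p : UpperPair n) : ∑ q, p.overlap q ≤ 4 * n := by
  simp only [overlap_eq_sum, Finset.sum_add_distrib, ← Finset.card_filter]
  linarith [card_filter_fst_eq_le p.1.1, card_filter_fst_eq_le p.1.2,
    card_filter_snd_eq_le p.1.1, card_filter_snd_eq_le p.1.2]

theorem sum_sum_overlap_le (n : ℕ) :
    (∑ p : UpperPair n, ∑ q, (p.overlap q : ℝ)) ≤ 4 * (n : ℝ) ^ 3 := by
  have h1 : ∀ p : UpperPair n, ∑ q, (p.overlap q : ℝ) ≤ 4 * n := fun p => by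
    exact_mod_cast sum_overlap_le p
  refine (Finset.sum_le_sum fun p _ => h1 p).trans ?_
  rw [Finset.sum_const, nsmul_eq_mul, Finset.card_univ]
  have h2 := two_mul_card n
  have hn : (0 : ℝ) ≤ n := n.cast_nonneg
  nlinarith [mul_nonneg hn hn, mul_nonneg (mul_nonneg hn hn) hn]

/-- Normal form with the shared index first; the symmetry of `truncTail` then makes the order within
each pair irrelevant. -/
theorem exists_of_overlap_eq_one {n : ℕ} {p q : UpperPair n} (h : p.overlap q = 1) :
    ∃ i j k : Fin n, i ≠ j ∧ i ≠ k ∧ j ≠ k ∧ (p.1 = (i, j) ∨ p.1 = (j, i)) ∧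
      (q.1 = (i, k) ∨ q.1 = (k, i)) := by
  rw [overlap_eq_sum] at h
  obtain ⟨⟨i, j⟩, hij⟩ := p
  obtain ⟨⟨k, l⟩, hkl⟩ := q
  simp only at *
  have h1 := hij.ne
  have h2 := hkl.ne
  by_cases a : i = k
  · subst a
    exact ⟨i, j, l, h1, h2, fun e => by simp [e] at h, .inl rfl, .inl rfl⟩
  by_cases b : i = l
  · subst b
    exact ⟨i, j, k, h1, h2.symm, fun e => by grind, .inl rfl, .inr rfl⟩
  by_cases c : j = k
  · subst c
    exact ⟨j, i, l, h1.symm, h2, b, .inr rfl, .inl rfl⟩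
  by_cases d : j = l
  · subst d
    exact ⟨j, i, k, h1.symm, h2.symm, a, .inr rfl, .inr rfl⟩
  simp [a, b, c, d] at h

end UpperPair

/-! ### First and second moments of the truncated tails. -/

section Truncated

variable {n : ℕ} (ρ s u c : ℝ)

/-- The truncated conditional exceedance probability attached to a pair. -/
noncomputable def truncTailPair {n : ℕ} (ρ s u c : ℝ) (p : UpperPair n) (x : Fin n → ℝ) : ℝ :=
  truncTail ρ s u c (x p.1.1) (x p.1.2)

theorem truncTailPair_nonneg (p : UpperPair n) (x : Fin n → ℝ) :
    0 ≤ truncTailPair ρ s u c p x := truncTail_nonneg ..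

theorem measurable_truncTailPair (p : UpperPair n) : Measurable (truncTailPair ρ s u c p) :=
  measurable_truncTail_eval ..

theorem truncTailPair_le_one (p : UpperPair n) (x : Fin n → ℝ) :
    truncTailPair ρ s u c p x ≤ 1 :=
  (truncTail_le_shiftedTail ..).trans (shiftedTail_le_one ..)

theorem memLp_truncTailPair (p : UpperPair n) (t : ENNReal) :
    MemLp (truncTailPair ρ s u c p) t (stdGaussianPi (Fin n)) :=
  MemLp.of_bound (measurable_truncTailPair ..).aestronglyMeasurable 1 (ae_of_all _ fun x => by
    rw [Real.norm_eq_abs, abs_of_nonneg (truncTailPair_nonneg ..)]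
    exact truncTailPair_le_one ..)

theorem integrable_shiftedTail_pair (p : UpperPair n) :
    Integrable (fun x => shiftedTail ρ s u (x p.1.1 + x p.1.2)) (stdGaussianPi (Fin n)) := by
  refine Integrable.of_bound (C := 1) ?_ (ae_of_all _ fun x => ?_)
  · exact ((measurable_shiftedTail ρ s u).comp
      ((measurable_pi_apply p.1.1).add (measurable_pi_apply p.1.2))).aestronglyMeasurable
  · rw [Real.norm_eq_abs, abs_of_nonneg (shiftedTail_nonneg ..)]
    exact shiftedTail_le_one ..

variable {ρ s}

theorem integral_truncTailPair_le (h : 2 * ρ ^ 2 + s ^ 2 = 1) (p : UpperPair n) :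
    ∫ x, truncTailPair ρ s u c p x ∂stdGaussianPi (Fin n) ≤
      (gaussianReal 0 1).real (Set.Ioi u) := by
  rw [← integral_shiftedTail h u p]
  exact integral_mono ((memLp_truncTailPair ρ s u c p 1).integrable le_rfl)
    (integrable_shiftedTail_pair ρ s u p) fun x => truncTail_le_shiftedTail ..

/-- What truncation removes is covered by the events `c < x i` and `c < x j`, each contributing at
most `K`. -/
theorem le_integral_truncTailPair (h : 2 * ρ ^ 2 + s ^ 2 = 1) {α β K : ℝ} (hα : 0 ≤ α) (hβ : 0 ≤ β)
    (hK : Real.exp (-α * u - β * c + ((α * ρ + β) ^ 2 + α ^ 2 * (1 - ρ ^ 2)) / 2) ≤ K)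
    (p : UpperPair n) :
    (gaussianReal 0 1).real (Set.Ioi u) - 2 * K ≤
      ∫ x, truncTailPair ρ s u c p x ∂stdGaussianPi (Fin n) := by
  set i := p.1.1
  set j := p.1.2
  have hij : i ≠ j := p.2.ne
  have h1 := (integral_shiftedTail_indicator_le hij h u c hα hβ).trans hK
  have hint : ∀ k : Fin n, Integrable (fun x => if c < x k then
      shiftedTail ρ s u (x i + x j) else 0) (stdGaussianPi (Fin n)) := fun k => by
      have hs : MeasurableSet {x : Fin n → ℝ | c < x k} :=
        measurableSet_lt measurable_const (measurable_pi_apply k)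
      exact (integrable_shiftedTail_pair ρ s u p).indicator hs
  have h3 : ∫ x, shiftedTail ρ s u (x i + x j) ∂stdGaussianPi (Fin n) ≤
      ∫ x, (truncTailPair ρ s u c p x + ((if c < x i then shiftedTail ρ s u (x i + x j) else 0) +
        (if c < x j then shiftedTail ρ s u (x i + x j) else 0))) ∂stdGaussianPi (Fin n) := by
    refine integral_mono (integrable_shiftedTail_pair ρ s u p)
      (((memLp_truncTailPair ρ s u c p 1).integrable le_rfl).add ((hint i).add (hint j)))
      fun x => ?_
    have h0 := shiftedTail_nonneg ρ s u (x i + x j)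
    simp only [truncTailPair, truncTail]
    by_cases a : x i ≤ c <;> by_cases b : x j ≤ c
    · simp [i, j, a, b, not_lt.2 a, not_lt.2 b]
    all_goals
      simp only [i, j] at *
      simp [a, b, not_le.1, h0]
    all_goals split_ifs <;> linarith
  have hadd := (hint i).add (hint j)
  simp only [Pi.add_def] at hadd
  rw [integral_add ((memLp_truncTailPair ρ s u c p 1).integrable le_rfl) hadd, integral_add (hint i) (hint j), integral_shiftedTail h u p] at h3
  have h4 : ∫ x, (if c < x j then shiftedTail ρ s u (x i + x j) else 0) ∂stdGaussianPi (Fin n)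
      ≤ K := by
    refine le_trans (le_of_eq ?_)
      ((integral_shiftedTail_indicator_le hij.symm h u c hα hβ).trans hK)
    congr with x
    rw [add_comm (x j)]
  linarith

/-- Three cases: equal pairs use `q² ≤ ε q`, disjoint pairs are independent, and pairs sharing one
index use the Chernoff bound `K`. -/
theorem integral_truncTailPair_mul_le (hρ : 0 ≤ ρ) (h : 2 * ρ ^ 2 + s ^ 2 = 1) {α β K ε : ℝ}
    (hα : 0 ≤ α) (hβ : 0 ≤ β)
    (hK : Real.exp (β * c - 2 * α * u + (2 * α * ρ - β) ^ 2 / 2 + α ^ 2 * (1 - ρ ^ 2)) ≤ K)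
    (hε : Real.exp (2 * ρ * c - u + 1 / 2) ≤ ε) (p q : UpperPair n) :
    ∫ x, truncTailPair ρ s u c p x * truncTailPair ρ s u c q x ∂stdGaussianPi (Fin n) ≤
      (∫ x, truncTailPair ρ s u c p x ∂stdGaussianPi (Fin n)) *
        (∫ x, truncTailPair ρ s u c q x ∂stdGaussianPi (Fin n))
      + ((if p = q then ε * ∫ x, truncTailPair ρ s u c p x ∂stdGaussianPi (Fin n) else 0)
      + p.overlap q * K) := by
  have hK0 : 0 ≤ K := (Real.exp_nonneg _).trans hK
  have hε0 : 0 ≤ ε := (Real.exp_nonneg _).trans hε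
  have hn : ∀ p : UpperPair n, 0 ≤ ∫ x, truncTailPair ρ s u c p x ∂stdGaussianPi (Fin n) :=
    fun p => integral_nonneg fun x => truncTailPair_nonneg ..
  have hpq := mul_nonneg (hn p) (hn q)
  by_cases hpq' : p = q
  · subst hpq'
    rw [if_pos rfl]
    have h1 : ∫ x, truncTailPair ρ s u c p x * truncTailPair ρ s u c p x ∂stdGaussianPi (Fin n) ≤
        ∫ x, ε * truncTailPair ρ s u c p x ∂stdGaussianPi (Fin n) := by
      refine integral_mono ((memLp_truncTailPair ρ s u c p 2).integrable_mul
        (memLp_truncTailPair ρ s u c p 2))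
        (((memLp_truncTailPair ρ s u c p 1).integrable le_rfl).const_mul ε) fun x => ?_
      exact mul_le_mul_of_nonneg_right ((truncTail_le_exp hρ (by nlinarith) ..).trans hε)
        (truncTailPair_nonneg ..)
    rw [integral_const_mul] at h1
    have : 0 ≤ (p.overlap p : ℝ) * K := by positivity
    linarith
  rw [if_neg hpq', zero_add]
  rcases Nat.le_one_iff_eq_zero_or_eq_one.1 (UpperPair.overlap_le_one_of_ne hpq') with ho | ho
  · rw [ho]
    have h1 : p.1.1 ≠ q.1.1 ∧ p.1.1 ≠ q.1.2 ∧ p.1.2 ≠ q.1.1 ∧ p.1.2 ≠ q.1.2 := by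
      rw [UpperPair.overlap_eq_sum] at ho
      refine ⟨?_, ?_, ?_, ?_⟩ <;> intro e <;> simp [e] at ho
    have hind := (iIndepFun_stdGaussianPi (Fin n)).indepFun_prodMk_prodMk
      (fun i => measurable_pi_apply i) p.1.1 p.1.2 q.1.1 q.1.2 h1.1 h1.2.1 h1.2.2.1 h1.2.2.2
    have h2 := (hind.comp (measurable_truncTail ρ s u c)
      (measurable_truncTail ρ s u c)).integral_mul_eq_mul_integral
      (measurable_truncTailPair ρ s u c p).aestronglyMeasurable
      (measurable_truncTailPair ρ s u c q).aestronglyMeasurable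
    simp only [Nat.cast_zero, zero_mul, add_zero]
    exact h2.le
  · rw [ho]
    obtain ⟨i, j, k, hij, hik, hjk, hp, hq⟩ := UpperPair.exists_of_overlap_eq_one ho
    have e1 : ∀ x, truncTailPair ρ s u c p x = truncTail ρ s u c (x i) (x j) := fun x => by
      rcases hp with hp | hp
      · simp [truncTailPair, hp]
      · simp [truncTailPair, hp, truncTail_comm ρ s u c (x i)]
    have e2 : ∀ x, truncTailPair ρ s u c q x = truncTail ρ s u c (x i) (x k) := fun x => by
      rcases hq with hq | hq
      · simp [truncTailPair, hq]
      · simp [truncTailPair, hq, truncTail_comm ρ s u c (x i)]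
    have h1 := (integral_truncTail_mul_le hij hik hjk h u c hα hβ).trans hK
    simp_rw [← e1, ← e2] at h1
    push_cast
    linarith

end Truncated

/-- Both products lie in `[0, 1]` and agree unless some coordinate exceeds `c`; a union bound
concludes. -/
theorem abs_integral_prod_sub_integral_prod_truncTailPair_le {n : ℕ} (ρ s u c : ℝ) :
    |∫ x, ∏ p : UpperPair n, (1 - shiftedTail ρ s u (x p.1.1 + x p.1.2)) ∂stdGaussianPi (Fin n) -
      ∫ x, ∏ p : UpperPair n, (1 - truncTailPair ρ s u c p x) ∂stdGaussianPi (Fin n)| ≤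
      n * (gaussianReal 0 1).real (Set.Ioi c) := by
  have hbd : ∀ a : UpperPair n → ℝ, (∀ p, 0 ≤ a p) → (∀ p, a p ≤ 1) →
      0 ≤ ∏ p, (1 - a p) ∧ ∏ p, (1 - a p) ≤ 1 := fun a h0 h1 =>
    ⟨Finset.prod_nonneg fun p _ => by linarith [h1 p],
      Finset.prod_le_one (fun p _ => by linarith [h1 p]) fun p _ => by linarith [h0 p]⟩
  have hT := fun x : Fin n → ℝ => hbd (fun p => shiftedTail ρ s u (x p.1.1 + x p.1.2))
    (fun _ => shiftedTail_nonneg ..) fun _ => shiftedTail_le_one ..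
  have hq := fun x : Fin n → ℝ => hbd (fun p => truncTailPair ρ s u c p x)
    (fun _ => truncTailPair_nonneg ..) fun _ => truncTailPair_le_one ..
  have mT : Measurable fun x : Fin n → ℝ =>
      ∏ p : UpperPair n, (1 - shiftedTail ρ s u (x p.1.1 + x p.1.2)) :=
    Finset.measurable_prod _ fun p _ => measurable_const.sub ((measurable_shiftedTail ρ s u).comp
      ((measurable_pi_apply p.1.1).add (measurable_pi_apply p.1.2)))
  have mq : Measurable fun x : Fin n → ℝ => ∏ p : UpperPair n, (1 - truncTailPair ρ s u c p x) :=
    Finset.measurable_prod _ fun p _ => measurable_const.sub (measurable_truncTailPair ..)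
  have iT := Integrable.of_bound (μ := stdGaussianPi (Fin n)) mT.aestronglyMeasurable 1
    (ae_of_all _ fun x => by rw [Real.norm_eq_abs, abs_of_nonneg (hT x).1]; exact (hT x).2)
  have iq := Integrable.of_bound (μ := stdGaussianPi (Fin n)) mq.aestronglyMeasurable 1
    (ae_of_all _ fun x => by rw [Real.norm_eq_abs, abs_of_nonneg (hq x).1]; exact (hq x).2)
  have hs : ∀ i : Fin n, MeasurableSet {x : Fin n → ℝ | c < x i} := fun i =>
    measurableSet_lt measurable_const (measurable_pi_apply i)
  have ind : ∀ i : Fin n, Integrable ({x : Fin n → ℝ | c < x i}.indicator fun _ => (1 : ℝ))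
      (stdGaussianPi (Fin n)) := fun i => (integrable_const 1).indicator (hs i)
  rw [← integral_sub iT iq]
  refine abs_integral_le_integral_abs.trans ?_
  have hle := integral_mono (μ := stdGaussianPi (Fin n)) (iT.sub iq).abs
    (integrable_finsetSum Finset.univ fun i _ => ind i) fun x => ?_
  · refine hle.trans_eq ?_
    rw [integral_finsetSum _ fun i _ => ind i]
    simp only [integral_indicator_const (1 : ℝ) (hs _)]
    have : ∀ i : Fin n, (stdGaussianPi (Fin n)).real {x | c < x i} =
        (gaussianReal 0 1).real (Set.Ioi c) := fun i => by
      rw [← stdGaussianPi_map_eval i, measureReal_def, measureReal_def,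
        Measure.map_apply (measurable_pi_apply i) measurableSet_Ioi]
      rfl
    simp [this]
  · have hnn : ∀ i, 0 ≤ {x : Fin n → ℝ | c < x i}.indicator (fun _ => (1 : ℝ)) x := fun i =>
      Set.indicator_nonneg (fun _ _ => zero_le_one) _
    by_cases hx : ∀ i, x i ≤ c
    · have e : ∀ p : UpperPair n, truncTailPair ρ s u c p x =
          shiftedTail ρ s u (x p.1.1 + x p.1.2) := fun p => by
        rw [truncTailPair, truncTail, if_pos ⟨hx _, hx _⟩]
      simp only [Pi.sub_apply, e, sub_self, abs_zero]
      exact Finset.sum_nonneg fun i _ => hnn i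
    · push Not at hx
      obtain ⟨i, hi⟩ := hx
      have h1 : 1 ≤ ∑ i, {x : Fin n → ℝ | c < x i}.indicator (fun _ => (1 : ℝ)) x := by
        refine le_trans (le_of_eq ?_) (Finset.single_le_sum (fun i _ => hnn i) (Finset.mem_univ i))
        simp [hi]
      refine le_trans ?_ h1
      have a := hT x
      have b := hq x
      simp only [Pi.sub_apply]
      rw [abs_le]
      constructor <;> linarith

/-- Squared bias plus variance: the product-of-means terms resum to the squared mean, leaving the
diagonal and overlap terms as the variance bound. -/
theorem integral_sq_sum_truncTailPair_sub_le {n : ℕ} {ρ s : ℝ} (u c : ℝ) (hρ : 0 ≤ ρ)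
    (h : 2 * ρ ^ 2 + s ^ 2 = 1) {α β K ε : ℝ} (hα : 0 ≤ α) (hβ : 0 ≤ β)
    (hK : Real.exp (β * c - 2 * α * u + (2 * α * ρ - β) ^ 2 / 2 + α ^ 2 * (1 - ρ ^ 2)) ≤ K)
    (hε : Real.exp (2 * ρ * c - u + 1 / 2) ≤ ε) (lam : ℝ) :
    ∫ x, (∑ p : UpperPair n, truncTailPair ρ s u c p x - lam) ^ 2 ∂stdGaussianPi (Fin n) ≤
      ((∫ x, ∑ p : UpperPair n, truncTailPair ρ s u c p x ∂stdGaussianPi (Fin n)) - lam) ^ 2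
        + ε * (∫ x, ∑ p : UpperPair n, truncTailPair ρ s u c p x ∂stdGaussianPi (Fin n))
        + 4 * n ^ 3 * K := by
  set q : UpperPair n → (Fin n → ℝ) → ℝ := truncTailPair ρ s u c
  set m : UpperPair n → ℝ := fun p => ∫ x, q p x ∂stdGaussianPi (Fin n)
  have hK0 : 0 ≤ K := (Real.exp_nonneg _).trans hK
  have iq : ∀ p, Integrable (q p) (stdGaussianPi (Fin n)) := fun p =>
    (memLp_truncTailPair ρ s u c p 1).integrable le_rfl
  have iqq : ∀ p p', Integrable (fun x => q p x * q p' x) (stdGaussianPi (Fin n)) := fun p p' =>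
    (memLp_truncTailPair ρ s u c p 2).integrable_mul (memLp_truncTailPair ρ s u c p' 2)
  have hS : ∫ x, ∑ p, q p x ∂stdGaussianPi (Fin n) = ∑ p, m p :=
    integral_finsetSum _ fun p _ => iq p
  have hSS : ∫ x, ∑ p, ∑ p', q p x * q p' x ∂stdGaussianPi (Fin n) ≤
      (∑ p, m p) ^ 2 + ε * (∑ p, m p) + 4 * n ^ 3 * K := by
    rw [integral_finsetSum _ fun p _ => integrable_finsetSum _ fun p' _ => iqq p p']
    simp_rw [integral_finsetSum _ fun p' _ => iqq _ p']
    refine (Finset.sum_le_sum fun p _ => Finset.sum_le_sum fun p' _ =>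
      integral_truncTailPair_mul_le u c hρ h hα hβ hK hε p p').trans ?_
    simp only [Finset.sum_add_distrib, ← Finset.sum_mul, Finset.sum_ite_eq, Finset.mem_univ,
      if_true, ← Finset.mul_sum]
    have h1 := mul_le_mul_of_nonneg_right (UpperPair.sum_sum_overlap_le n) hK0
    have e : ∀ p, ∫ x, truncTailPair ρ s u c p x ∂stdGaussianPi (Fin n) = m p := fun _ => rfl
    simp only [e]
    linarith [sq (∑ p, m p)]
  have hpt : ∀ x, (∑ p, q p x - lam) ^ 2 =
      ∑ p, ∑ p', q p x * q p' x - 2 * lam * ∑ p, q p x + lam ^ 2 := fun x => by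
    rw [← Finset.sum_mul_sum]; ring
  have i1 : Integrable (fun x => ∑ p, ∑ p', q p x * q p' x) (stdGaussianPi (Fin n)) :=
    integrable_finsetSum _ fun p _ => integrable_finsetSum _ fun p' _ => iqq p p'
  have i2 : Integrable (fun x => 2 * lam * ∑ p, q p x) (stdGaussianPi (Fin n)) :=
    (integrable_finsetSum _ fun p _ => iq p).const_mul _
  have i12 : Integrable (fun x => ∑ p, ∑ p', q p x * q p' x - 2 * lam * ∑ p, q p x)
    (stdGaussianPi (Fin n)) := i1.sub i2
  simp_rw [hpt]
  rw [integral_add i12 (integrable_const _), integral_sub i1 i2, integral_const_mul, hS,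
    integral_const]
  simp only [probReal_univ, one_smul]
  linarith [hSS]

/-! ### Assembly of the error bounds. -/

/-- Quantitative Poisson approximation for the maximum of the model field. -/
theorem abs_pairModelMeasure_real_sub_exp_neg_le {n : ℕ} {ρ s u c ε lam α β α' β' K K' : ℝ}
    (hρ : 0 ≤ ρ) (h : 2 * ρ ^ 2 + s ^ 2 = 1) (hl : 0 ≤ lam)
    (hε : Real.exp (2 * ρ * c - u + 1 / 2) ≤ ε) (hε' : ε ≤ 1 / 2)
    (hα : 0 ≤ α) (hβ : 0 ≤ β)
    (hK : Real.exp (-α * u - β * c + ((α * ρ + β) ^ 2 + α ^ 2 * (1 - ρ ^ 2)) / 2) ≤ K)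
    (hα' : 0 ≤ α') (hβ' : 0 ≤ β')
    (hK' : Real.exp (β' * c - 2 * α' * u + (2 * α' * ρ - β') ^ 2 / 2 + α' ^ 2 * (1 - ρ ^ 2)) ≤ K')
    {A : ℝ} (hA : A = Fintype.card (UpperPair n) * (gaussianReal 0 1).real (Set.Ioi u)) :
    |(pairModelMeasure n).real {z | ∀ p, pairModel ρ s p z ≤ u} - Real.exp (-lam)| ≤
      n * (gaussianReal 0 1).real (Set.Ioi c) + (2 * ε * A +
        √((|A - lam| + 2 * (Fintype.card (UpperPair n) * K)) ^ 2 + ε * A + 4 * n ^ 3 * K')) := by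
  have hs : s ^ 2 ≤ 1 := by nlinarith
  have hε0 : 0 ≤ ε := (Real.exp_nonneg _).trans hε
  have hK0 : 0 ≤ K := (Real.exp_nonneg _).trans hK
  have h1 := abs_integral_prod_sub_integral_prod_truncTailPair_le (n := n) ρ s u c
  have h2 := abs_integral_prod_one_sub_sub_exp_neg_le (μ := stdGaussianPi (Fin n))
    (q := truncTailPair (n := n) ρ s u c) (measurable_truncTailPair ρ s u c)
    (truncTailPair_nonneg ρ s u c) (fun p x => (truncTail_le_exp hρ hs ..).trans hε) hε' hl
  have h3 := integral_sq_sum_truncTailPair_sub_le (n := n) u c hρ h hα' hβ' hK' hε lam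
  have iq : ∀ p : UpperPair n, Integrable (truncTailPair ρ s u c p) (stdGaussianPi (Fin n)) :=
    fun p => (memLp_truncTailPair ρ s u c p 1).integrable le_rfl
  set m := ∫ x, ∑ p : UpperPair n, truncTailPair ρ s u c p x ∂stdGaussianPi (Fin n) with hm
  rw [integral_finsetSum _ fun p _ => iq p] at hm
  have hm1 : m ≤ A := by
    rw [hm, hA]
    refine (Finset.sum_le_sum fun p _ => integral_truncTailPair_le u c h p).trans_eq ?_
    simp
  have hm2 : A - 2 * (Fintype.card (UpperPair n) * K) ≤ m := by
    rw [hm, hA]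
    refine le_trans (le_of_eq ?_)
      (Finset.sum_le_sum fun p _ => le_integral_truncTailPair u c h hα hβ hK p)
    simp
    ring
  have hmA : |m - lam| ≤ |A - lam| + 2 * (Fintype.card (UpperPair n) * K) := by
    have := abs_sub_abs_le_abs_sub (A - lam) (m - lam)
    calc |m - lam| = |(A - lam) + (m - A)| := by ring_nf
      _ ≤ |A - lam| + |m - A| := abs_add_le _ _
      _ ≤ _ := by
        rw [abs_of_nonpos (by linarith : m - A ≤ 0)]
        linarith
  rw [pairModelMeasure_real_forall_le]
  have h4 : √(∫ x, (∑ p : UpperPair n, truncTailPair ρ s u c p x - lam) ^ 2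
      ∂stdGaussianPi (Fin n)) ≤
      √((|A - lam| + 2 * (Fintype.card (UpperPair n) * K)) ^ 2 + ε * A + 4 * n ^ 3 * K') := by
    refine Real.sqrt_le_sqrt (h3.trans ?_)
    have : (m - lam) ^ 2 ≤ (|A - lam| + 2 * (Fintype.card (UpperPair n) * K)) ^ 2 := by
      rw [← sq_abs]
      exact pow_le_pow_left₀ (abs_nonneg _) hmA 2
    have := mul_le_mul_of_nonneg_left hm1 hε0
    linarith
  have h5 : 2 * ε * m ≤ 2 * ε * A := mul_le_mul_of_nonneg_left hm1 (by linarith)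
  refine (abs_sub_le _ _ _).trans (add_le_add h1 (h2.trans (add_le_add h5 h4)))

/-! ### Gaussian tail asymptotics. -/

/-- Two-sided Mills ratio bounds for the standard Gaussian tail. -/
theorem gaussianReal_real_Ioi_bounds {t : ℝ} (ht : 0 < t) :
    (gaussianReal 0 1).real (Set.Ioi t) ≤ Real.exp (-t ^ 2 / 2) / (√(2 * Real.pi) * t) ∧
      Real.exp (-t ^ 2 / 2) / (√(2 * Real.pi) * t) ≤
        (1 + 1 / t ^ 2) * (gaussianReal 0 1).real (Set.Ioi t) := by
  -- With `φ` the Gaussian density, `g x = -φ x / x` has derivative `φ x (1 + 1/x²)`, and on `(t,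
  -- ∞)` the second factor lies between `1` and `1 + 1/t²`.
  set g : ℝ → ℝ := fun x => -(Real.exp (-x ^ 2 / 2) / (√(2 * Real.pi) * x)) with hg
  have hpi : 0 < √(2 * Real.pi) := by positivity
  have hpdf : ∀ x, gaussianPDFReal 0 1 x = Real.exp (-x ^ 2 / 2) / √(2 * Real.pi) := fun x => by
    simp [gaussianPDFReal]; ring
  have hderiv : ∀ x ∈ Set.Ici t, HasDerivAt g (gaussianPDFReal 0 1 x * (1 + 1 / x ^ 2)) x := by
    intro x hx
    have hx0 : x ≠ 0 := (ht.trans_le hx).ne'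
    have h1 : HasDerivAt (fun x : ℝ => -x ^ 2 / 2) (-x) x := by
      refine ((hasDerivAt_pow 2 x).neg.div_const 2).congr_deriv ?_
      ring
    have h2 : HasDerivAt (fun x : ℝ => √(2 * Real.pi) * x) √(2 * Real.pi) x := by
      simpa using (hasDerivAt_id x).const_mul √(2 * Real.pi)
    have h3 := (h1.exp.div h2 (mul_ne_zero hpi.ne' hx0)).neg
    refine h3.congr_deriv ?_
    rw [hpdf]
    field_simp
    ring
  have hpos : ∀ x ∈ Set.Ioi t, 0 ≤ gaussianPDFReal 0 1 x * (1 + 1 / x ^ 2) := fun x _ =>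
    mul_nonneg (gaussianPDFReal_nonneg _ _ _) (by positivity)
  have hlim : Tendsto g atTop (𝓝 0) := by
    have h1 : Tendsto (fun x : ℝ => (√(2 * Real.pi) * x)⁻¹) atTop (𝓝 0) :=
      (tendsto_id.const_mul_atTop hpi).inv_tendsto_atTop
    refine squeeze_zero_norm' ?_ h1
    filter_upwards [eventually_gt_atTop 0] with x hx
    rw [hg, norm_neg, Real.norm_eq_abs, abs_of_nonneg (by positivity), div_eq_mul_inv]
    refine mul_le_of_le_one_left (by positivity) (Real.exp_le_one_iff.2 ?_)
    nlinarith [sq_nonneg x]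
  have hint := integral_Ioi_of_hasDerivAt_of_nonneg' hderiv hpos hlim
  have hi := integrableOn_Ioi_deriv_of_nonneg' hderiv hpos hlim
  have hip : IntegrableOn (gaussianPDFReal 0 1) (Set.Ioi t) :=
    (integrable_gaussianPDFReal 0 1).integrableOn
  have hreal : (gaussianReal 0 1).real (Set.Ioi t) = ∫ x in Set.Ioi t, gaussianPDFReal 0 1 x := by
    rw [measureReal_def, gaussianReal_apply_eq_integral 0 one_ne_zero,
      ENNReal.toReal_ofReal (integral_nonneg fun x => gaussianPDFReal_nonneg _ _ _)]
  have e : 0 - g t = Real.exp (-t ^ 2 / 2) / (√(2 * Real.pi) * t) := by simp [hg]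
  rw [← e, ← hint, hreal]
  constructor
  · refine setIntegral_mono_on hip hi measurableSet_Ioi fun x _ => ?_
    refine le_mul_of_one_le_right (gaussianPDFReal_nonneg _ _ _) ?_
    have : 0 ≤ 1 / x ^ 2 := by positivity
    linarith
  · rw [← integral_const_mul]
    refine setIntegral_mono_on hi (hip.const_mul _) measurableSet_Ioi fun x hx => ?_
    rw [mul_comm]
    refine mul_le_mul_of_nonneg_right ?_ (gaussianPDFReal_nonneg _ _ _)
    have : 1 / x ^ 2 ≤ 1 / t ^ 2 :=
      one_div_le_one_div_of_le (by positivity) (pow_le_pow_left₀ ht.le (le_of_lt hx) 2)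
    linarith

theorem tendsto_gaussianReal_real_Ioi_mul {ι : Type*} {l : Filter ι} {t : ι → ℝ}
    (ht : Tendsto t l atTop) :
    Tendsto (fun i => (gaussianReal 0 1).real (Set.Ioi (t i)) *
      (√(2 * Real.pi) * t i * Real.exp (t i ^ 2 / 2))) l (𝓝 1) := by
  have h1 : Tendsto (fun i => (1 + 1 / t i ^ 2)⁻¹) l (𝓝 1) := by
    have : Tendsto (fun i => 1 / t i ^ 2) l (𝓝 0) := by
      simp_rw [one_div]
      exact ((tendsto_pow_atTop two_ne_zero).comp ht).inv_tendsto_atTop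
    simpa using (this.const_add 1).inv₀ (by simp)
  have hev := ht.eventually_gt_atTop 0
  have hE : ∀ x : ℝ, Real.exp (-x ^ 2 / 2) = (Real.exp (x ^ 2 / 2))⁻¹ := fun x => by
    rw [← Real.exp_neg]; congr 1; ring
  refine tendsto_of_tendsto_of_tendsto_of_le_of_le' h1 tendsto_const_nhds ?_ ?_
  · filter_upwards [hev] with i hi
    have h := (gaussianReal_real_Ioi_bounds hi).2
    rw [hE, inv_div_left, inv_le_iff_one_le_mul₀' (by positivity)] at h
    rw [inv_le_iff_one_le_mul₀' (by positivity)]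
    linarith
  · filter_upwards [hev] with i hi
    have h := (gaussianReal_real_Ioi_bounds hi).1
    rw [hE, inv_div_left] at h
    have hp : 0 < √(2 * Real.pi) * t i * Real.exp (t i ^ 2 / 2) := by positivity
    rwa [← one_div, le_div_iff₀ hp] at h

/-! ### From distribution functions to convergence in distribution. -/

/-- Convergence of the distribution functions to a continuous distribution function implies
convergence in distribution. -/
theorem tendsto_probabilityMeasure_of_tendsto_cdf {μ : ℕ → ProbabilityMeasure ℝ}
    {ν : ProbabilityMeasure ℝ}
    (h : ∀ x, Tendsto (fun n => (μ n : Measure ℝ).real (Set.Iic x)) atTop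
      (𝓝 ((ν : Measure ℝ).real (Set.Iic x)))) :
    Tendsto μ atTop (𝓝 ν) := by
  -- Half-open intervals form a π-system containing arbitrarily small neighbourhoods of each point,
  -- and their masses are differences of distribution functions.
  refine IsPiSystem.tendsto_probabilityMeasure_of_tendsto_of_mem
    (S := {s : Set ℝ | ∃ a b : ℝ, a < b ∧ s = Set.Ioc a b}) ?_ ?_ ?_ ?_
  · rintro _ ⟨a, b, _, rfl⟩ _ ⟨a', b', _, rfl⟩ hne
    rw [Set.Ioc_inter_Ioc] at hne ⊢
    obtain ⟨x, hx⟩ := hne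
    exact ⟨_, _, hx.1.trans_le hx.2, rfl⟩
  · rintro _ ⟨a, b, _, rfl⟩
    exact measurableSet_Ioc
  · intro u hu x hx
    obtain ⟨ε, hε, hb⟩ := Metric.isOpen_iff.1 hu x hx
    refine ⟨Set.Ioc (x - ε / 2) (x + ε / 2), ⟨_, _, by linarith, rfl⟩,
      Ioc_mem_nhds (by linarith) (by linarith), fun y hy => hb ?_⟩
    rw [Metric.mem_ball, Real.dist_eq, abs_lt]
    constructor <;> linarith [hy.1, hy.2]
  · rintro _ ⟨a, b, hab, rfl⟩
    have e : ∀ m : ProbabilityMeasure ℝ, ((m (Set.Ioc a b) : NNReal) : ℝ) =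
        (m : Measure ℝ).real (Set.Iic b) - (m : Measure ℝ).real (Set.Iic a) := fun m => by
      rw [← measureReal_sdiff (Set.Iic_subset_Iic.2 hab.le) measurableSet_Iic, Set.Iic_sdiff_Iic]
      rfl
    rw [← NNReal.tendsto_coe]
    simp_rw [e]
    exact (h b).sub (h a)

theorem gumbelMeasure_real_Iic (x : ℝ) :
    gumbelMeasure.real (Set.Iic x) = Real.exp (-Real.exp (-x)) := by
  rw [← cdf_gumbelMeasure, cdf_eq_real]

/-- The level `u` at which the rescaled maximum of the field equals `x`. -/
noncomputable def gumbelLevel (n : ℕ) (x : ℝ) : ℝ :=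
  √2 * cSeq n - (Real.log (4 * √Real.pi * cSeq n) - x) / (√2 * cSeq n)

theorem cSeq_pos {n : ℕ} (hn : 2 ≤ n) : 0 < cSeq n :=
  Real.sqrt_pos.2 (mul_pos two_pos (Real.log_pos (by exact_mod_cast hn)))

theorem aemeasurable_fieldMax {Ω : Type*} [MeasurableSpace Ω] {n : ℕ} {r : ℝ}
    {G : UpperPair n → Ω → ℝ} {P : Measure Ω} (hG : IsSparseEquicorrelatedField n r G P) :
    AEMeasurable (fieldMax G) P :=
  AEMeasurable.iSup fun p => hG.isGaussianProcess.aemeasurable p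

theorem rescaled_fieldMax_le_iff {Ω : Type*} {n : ℕ} (hn : 2 ≤ n) (G : UpperPair n → Ω → ℝ) (ω : Ω)
    (x : ℝ) :
    √2 * cSeq n * (fieldMax G ω - √2 * cSeq n
      + Real.log (4 * √Real.pi * cSeq n) / (√2 * cSeq n)) ≤ x ↔
    ∀ p, G p ω ≤ gumbelLevel n x := by
  have hc : 0 < √2 * cSeq n := mul_pos (by positivity) (cSeq_pos hn)
  have : Nonempty (UpperPair n) := ⟨⟨(⟨0, by omega⟩, ⟨1, by omega⟩), by simp⟩⟩
  rw [← ciSup_le_iff (Set.finite_range _).bddAbove, ← fieldMax, mul_comm, ← le_div_iff₀ hc,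
    gumbelLevel, sub_div]
  constructor <;> intro h <;> linarith

theorem IsSparseEquicorrelatedField.real_forall_le {Ω : Type*} [MeasurableSpace Ω] {n : ℕ} {r : ℝ}
    {G : UpperPair n → Ω → ℝ} {P : Measure Ω} (hG : IsSparseEquicorrelatedField n r G P)
    (hr : r ∈ Set.Icc (0 : ℝ) (1 / 2)) (u : ℝ) :
    P.real {ω | ∀ p, G p ω ≤ u} =
      (pairModelMeasure n).real {z | ∀ p, pairModel √r √(1 - 2 * r) p z ≤ u} := by
  have hs : MeasurableSet {y : UpperPair n → ℝ | ∀ p, y p ≤ u} := by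
    rw [Set.ofPred_forall]
    exact MeasurableSet.iInter fun p => measurableSet_le (measurable_pi_apply p) measurable_const
  have h1 : AEMeasurable (fun ω p => G p ω) P :=
    aemeasurable_pi_lambda _ fun p => hG.isGaussianProcess.aemeasurable p
  have h2 : AEMeasurable (fun z (p : UpperPair n) => pairModel √r √(1 - 2 * r) p z)
      (pairModelMeasure n) := (hasGaussianLaw_pairModel n _ _).aemeasurable
  have h := congrArg (fun m => m {y : UpperPair n → ℝ | ∀ p, y p ≤ u}) (hG.map_eq hr)
  simp only [Measure.map_apply_of_aemeasurable h1 hs, Measure.map_apply_of_aemeasurable h2 hs] at h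
  rw [measureReal_def, measureReal_def]
  exact congrArg ENNReal.toReal h

theorem tendstoInDistribution_of_pairModel {Ω : ℕ → Type*} [∀ n, MeasurableSpace (Ω n)]
    (P : (n : ℕ) → Measure (Ω n)) [∀ n, IsProbabilityMeasure (P n)]
    (r : ℕ → ℝ) (hr : ∀ n, r n ∈ Set.Icc (0 : ℝ) (1 / 2))
    (G : (n : ℕ) → UpperPair n → Ω n → ℝ)
    (hG : ∀ n, IsSparseEquicorrelatedField n (r n) (G n) (P n))
    (h : ∀ x, Tendsto (fun n => (pairModelMeasure n).real
      {z | ∀ p, pairModel √(r n) √(1 - 2 * r n) p z ≤ gumbelLevel n x}) atTop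
      (𝓝 (Real.exp (-Real.exp (-x))))) :
    TendstoInDistribution
      (fun n ω => √2 * cSeq n *
        (fieldMax (G n) ω - √2 * cSeq n
          + Real.log (4 * √Real.pi * cSeq n) / (√2 * cSeq n)))
      atTop (id : ℝ → ℝ) P gumbelMeasure := by
  have hm : ∀ n, AEMeasurable (fun ω => √2 * cSeq n * (fieldMax (G n) ω - √2 * cSeq n
          + Real.log (4 * √Real.pi * cSeq n) / (√2 * cSeq n))) (P n) := fun n =>
    (((aemeasurable_fieldMax (hG n)).sub_const _).add_const _).const_mul _
  refine ⟨hm, aemeasurable_id, tendsto_probabilityMeasure_of_tendsto_cdf fun x => ?_⟩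
  simp only [ProbabilityMeasure.coe_mk, Measure.map_id, gumbelMeasure_real_Iic]
  refine (h x).congr' ?_
  filter_upwards [eventually_ge_atTop 2] with n hn
  rw [← (hG n).real_forall_le (hr n), measureReal_def, measureReal_def,
    Measure.map_apply_of_aemeasurable (hm n) measurableSet_Iic]
  congr 2
  ext ω
  exact (rescaled_fieldMax_le_iff hn (G n) ω x).symm

/-! ### Optimising the Chernoff exponents. -/

/-- Exponent of the Chernoff bound for exceeding the level when one coordinate exceeds `c`. -/
theorem exists_chernoff_exponent_truncated {ρ c w L : ℝ} (hρ : 0 ≤ ρ) (hρ' : √2 * ρ ≤ 1)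
    (hc : 0 < c) (hL : 0 ≤ L) (hw : w * c ≤ L) :
    ∃ α β : ℝ, 0 ≤ α ∧ 0 ≤ β ∧
      -α * (√2 * c - w) - β * c + ((α * ρ + β) ^ 2 + α ^ 2 * (1 - ρ ^ 2)) / 2 ≤
        -c ^ 2 - (c * (1 - √2 * ρ)) ^ 2 / 2 + 3 * L := by
  have ht : √2 ^ 2 = (2 : ℝ) := Real.sq_sqrt (by norm_num)
  have ht1 : (1.4 : ℝ) ≤ √2 := Real.le_sqrt_of_sq_le (by norm_num)
  have ht2 : √2 ≤ (1.42 : ℝ) := Real.sqrt_le_iff.2 ⟨by norm_num, by norm_num⟩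
  set t := √2
  have hρ2 : ρ ^ 2 ≤ 1 / 2 := by nlinarith [mul_nonneg (by linarith : 0 ≤ t) hρ]
  have hρ1 : ρ ≤ 1 := by nlinarith
  have hD : 0 < 1 - ρ ^ 2 := by linarith
  set D := 1 - ρ ^ 2 with hDdef
  -- The stationary point of the quadratic at `w = 0`: `α ρ + β = c` and `α D = c (t - ρ)`.
  refine ⟨c * (t - ρ) / D, c * (1 - t * ρ) / D, ?_, ?_, ?_⟩
  · exact div_nonneg (mul_nonneg hc.le (by linarith)) hD.le
  · exact div_nonneg (mul_nonneg hc.le (by linarith)) hD.le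
  have e : -(c * (t - ρ) / D) * (t * c - w) - c * (1 - t * ρ) / D * c +
      ((c * (t - ρ) / D * ρ + c * (1 - t * ρ) / D) ^ 2 + (c * (t - ρ) / D) ^ 2 * D) / 2 =
      (t - ρ) / D * (w * c) - c ^ 2 - (c * (1 - t * ρ)) ^ 2 / (2 * D) := by
    have e1 : c * (t - ρ) / D * ρ + c * (1 - t * ρ) / D = c := by
      field_simp
      rw [hDdef]
      ring
    rw [e1]
    field_simp
    linear_combination (-c * (1 - ρ ^ 2)) * ht
  rw [e]
  have h1 : (t - ρ) / D * (w * c) ≤ 3 * L := by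
    have h2 : 0 ≤ (t - ρ) / D := div_nonneg (by linarith) hD.le
    have h3 : (t - ρ) / D ≤ 3 := by
      rw [div_le_iff₀ hD]
      linarith
    nlinarith [mul_le_mul_of_nonneg_left hw h2]
  have h4 : (c * (1 - t * ρ)) ^ 2 / 2 ≤ (c * (1 - t * ρ)) ^ 2 / (2 * D) :=
    div_le_div_of_nonneg_left (sq_nonneg _) (by positivity) (by nlinarith)
  linarith

/-- Exponent of the Chernoff bound for two overlapping pairs exceeding the level while the common
coordinate is at most `c`. -/
theorem exists_chernoff_exponent_overlap {ρ c w L : ℝ} (hρ : 0 ≤ ρ) (hρ' : √2 * ρ ≤ 1)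
    (hc : 0 < c) (hL : 0 ≤ L) (hw : w * c ≤ L) :
    ∃ α β : ℝ, 0 ≤ α ∧ 0 ≤ β ∧
      β * c - 2 * α * (√2 * c - w) + (2 * α * ρ - β) ^ 2 / 2 + α ^ 2 * (1 - ρ ^ 2) ≤
        -(3 / 2) * c ^ 2 - (c * (1 - √2 * ρ)) ^ 2 / 10 + 6 * L := by
  have ht : √2 ^ 2 = (2 : ℝ) := Real.sq_sqrt (by norm_num)
  have ht1 : (1.4 : ℝ) ≤ √2 := Real.le_sqrt_of_sq_le (by norm_num)
  have ht2 : √2 ≤ (1.42 : ℝ) := Real.sqrt_le_iff.2 ⟨by norm_num, by norm_num⟩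
  set t := √2
  have hρ2 : ρ ^ 2 ≤ 1 / 2 := by nlinarith [mul_nonneg (by linarith : 0 ≤ t) hρ]
  have hρ1 : ρ ≤ 1 := by nlinarith
  -- The unconstrained minimiser has `β ≥ 0` only for `ρ ≥ √2 - 1`; `1/2` is a convenient threshold
  -- above that.
  rcases le_total (1 / 2) ρ with h | h
  · have hD : 0 < 1 - ρ ^ 2 := by linarith
    set D := 1 - ρ ^ 2 with hDdef
    -- The stationary point at `w = 0`: `2αρ - β = c` and `α D = c (t - ρ)`.
    refine ⟨c * (t - ρ) / D, 2 * (c * (t - ρ) / D) * ρ - c, ?_, ?_, ?_⟩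
    · exact div_nonneg (mul_nonneg hc.le (by linarith)) hD.le
    · have e : 2 * (c * (t - ρ) / D) * ρ - c = c * ((2 * t * ρ - ρ ^ 2 - 1) / D) := by
        field_simp
        rw [hDdef]
        ring
      rw [e]
      refine mul_nonneg hc.le (div_nonneg ?_ hD.le)
      nlinarith [mul_nonneg (sub_nonneg.2 h) (by linarith : 0 ≤ 1 - ρ)]
    have e : (2 * (c * (t - ρ) / D) * ρ - c) * c - 2 * (c * (t - ρ) / D) * (t * c - w) +
        (2 * (c * (t - ρ) / D) * ρ - (2 * (c * (t - ρ) / D) * ρ - c)) ^ 2 / 2 +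
        (c * (t - ρ) / D) ^ 2 * D =
        2 * ((t - ρ) / D) * (w * c) - (3 / 2) * c ^ 2 - (c * (1 - t * ρ)) ^ 2 / D := by
      field_simp
      linear_combination (-2 * c * (1 - ρ ^ 2) ^ 2) * ht
    rw [e]
    have h1 : 2 * ((t - ρ) / D) * (w * c) ≤ 6 * L := by
      have h2 : 0 ≤ (t - ρ) / D := div_nonneg (by linarith) hD.le
      have h3 : (t - ρ) / D ≤ 3 := by
        rw [div_le_iff₀ hD]
        linarith
      nlinarith [mul_le_mul_of_nonneg_left hw h2]
    have h4 : (c * (1 - t * ρ)) ^ 2 / 10 ≤ (c * (1 - t * ρ)) ^ 2 / D :=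
      div_le_div_of_nonneg_left (sq_nonneg _) (by positivity) (by nlinarith)
    linarith
  · have hD : 0 < 1 + ρ ^ 2 := by positivity
    set D := 1 + ρ ^ 2 with hDdef
    -- For small `ρ` no tilt is needed: with `β = 0` the optimal `α` gives `-2c² / (1 + ρ²)` at `w =
    -- 0`.
    refine ⟨t * c / D, 0, by positivity, le_rfl, ?_⟩
    have e : 0 * c - 2 * (t * c / D) * (t * c - w) + (2 * (t * c / D) * ρ - 0) ^ 2 / 2 +
        (t * c / D) ^ 2 * (1 - ρ ^ 2) = 2 * (t / D) * (w * c) - 2 * c ^ 2 / D := by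
      have e1 : 1 - ρ ^ 2 = D - 2 * ρ ^ 2 := by rw [hDdef]; ring
      rw [e1]
      field_simp
      linear_combination (-2 * c ^ 2 * (1 + ρ ^ 2)) * ht
    rw [e]
    have h1 : 2 * (t / D) * (w * c) ≤ 6 * L := by
      have h2 : 0 ≤ t / D := by positivity
      have h3 : t / D ≤ 3 := by
        rw [div_le_iff₀ hD]
        nlinarith
      nlinarith [mul_le_mul_of_nonneg_left hw h2]
    -- As `8/5 = 3/2 + 1/10`, the surplus `c²/10` pays for the `δ²/10` term because `δ ≤ c`.
    have h2 : 8 / 5 * c ^ 2 ≤ 2 * c ^ 2 / D := by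
      rw [le_div_iff₀ hD]
      have hD' : D ≤ 5 / 4 := by rw [hDdef]; nlinarith
      nlinarith [mul_le_mul_of_nonneg_left hD' (sq_nonneg c)]
    have h3 : (c * (1 - t * ρ)) ^ 2 ≤ c ^ 2 := by
      rw [mul_pow]
      refine mul_le_of_le_one_right (sq_nonneg c) ?_
      have : 0 ≤ t * ρ := by positivity
      nlinarith
    linarith

/-! ### Asymptotics of the level. -/

theorem tendsto_cSeq : Tendsto cSeq atTop atTop :=
  Real.tendsto_sqrt_atTop.comp
    ((Real.tendsto_log_atTop.comp tendsto_natCast_atTop_atTop).const_mul_atTop two_pos)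

theorem cSeq_sq {n : ℕ} (hn : 1 ≤ n) : cSeq n ^ 2 = 2 * Real.log n :=
  Real.sq_sqrt (mul_nonneg zero_le_two (Real.log_nonneg (by exact_mod_cast hn)))

theorem exp_half_cSeq_sq {n : ℕ} (hn : 1 ≤ n) : Real.exp (cSeq n ^ 2 / 2) = n := by
  rw [cSeq_sq hn, mul_div_cancel_left₀ _ two_ne_zero, Real.exp_log (by exact_mod_cast hn)]

/-- The correction `√2 c_n - u_n` of the level. -/
noncomputable def levelCorrection (n : ℕ) (x : ℝ) : ℝ :=
  (Real.log (4 * √Real.pi * cSeq n) - x) / (√2 * cSeq n)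

theorem gumbelLevel_eq (n : ℕ) (x : ℝ) :
    gumbelLevel n x = √2 * cSeq n - levelCorrection n x := rfl

theorem levelCorrection_mul {n : ℕ} (hn : 2 ≤ n) (x : ℝ) :
    levelCorrection n x * cSeq n = (Real.log (4 * √Real.pi) + Real.log (cSeq n) - x) / √2 := by
  have hc := cSeq_pos hn
  rw [levelCorrection, Real.log_mul (by positivity) hc.ne']
  field_simp

theorem tendsto_log_cSeq : Tendsto (fun n => Real.log (cSeq n)) atTop atTop :=
  Real.tendsto_log_atTop.comp tendsto_cSeq

theorem tendsto_levelCorrection (x : ℝ) : Tendsto (fun n => levelCorrection n x) atTop (𝓝 0) := by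
  have h1 : Tendsto (fun n => Real.log (cSeq n) / cSeq n) atTop (𝓝 0) :=
    (Real.isLittleO_log_id_atTop.tendsto_div_nhds_zero).comp tendsto_cSeq
  have h2 : Tendsto (fun n => (Real.log (4 * √Real.pi) - x) / cSeq n) atTop (𝓝 0) :=
    tendsto_const_nhds.div_atTop tendsto_cSeq
  have h3 := (h1.add h2).div_const √2
  rw [add_zero, zero_div] at h3
  refine h3.congr' ?_
  filter_upwards [eventually_ge_atTop 2] with n hn
  have hc := cSeq_pos hn
  have h := levelCorrection_mul hn x
  rw [eq_comm, ← mul_left_inj' hc.ne', h]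
  field_simp
  ring

theorem eventually_levelCorrection_mul_le (x : ℝ) :
    ∀ᶠ n in atTop, levelCorrection n x * cSeq n ≤ Real.log (cSeq n) := by
  -- The constant `2/5` is a lower bound for `√2 - 1`, the room left by `log c / √2 ≤ log c`.
  filter_upwards [eventually_ge_atTop 2, tendsto_log_cSeq.eventually_ge_atTop 0,
    tendsto_log_cSeq.eventually_ge_atTop ((Real.log (4 * √Real.pi) - x) / (2 / 5))] with n hn h0 h
  have ht1 : (1.4 : ℝ) ≤ √2 := Real.le_sqrt_of_sq_le (by norm_num)
  rw [levelCorrection_mul hn, div_le_iff₀ (by positivity)]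
  rw [div_le_iff₀ (by norm_num)] at h
  nlinarith

theorem tendsto_gumbelLevel_div_cSeq (x : ℝ) :
    Tendsto (fun n => gumbelLevel n x / cSeq n) atTop (𝓝 √2) := by
  have h := ((tendsto_levelCorrection x).div_atTop tendsto_cSeq).const_sub √2
  rw [sub_zero] at h
  refine h.congr' ?_
  filter_upwards [eventually_ge_atTop 2] with n hn
  have hc := cSeq_pos hn
  rw [gumbelLevel_eq]
  field_simp

theorem tendsto_gumbelLevel (x : ℝ) : Tendsto (fun n => gumbelLevel n x) atTop atTop := by
  have h := tendsto_cSeq.atTop_mul_pos (by positivity) (tendsto_gumbelLevel_div_cSeq x)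
  refine h.congr' ?_
  filter_upwards [eventually_ge_atTop 2] with n hn
  have hc := cSeq_pos hn
  field_simp

/-- Since `exp (c²/2) = n`, Mills' ratio makes the product asymptotic to `1 / (√(2π) c)`. -/
theorem tendsto_nat_mul_gaussian_tail_cSeq :
    Tendsto (fun n : ℕ => n * (gaussianReal 0 1).real (Set.Ioi (cSeq n))) atTop (𝓝 0) := by
  have h := (tendsto_gaussianReal_real_Ioi_mul tendsto_cSeq).div_atTop
    (tendsto_cSeq.const_mul_atTop (by positivity : 0 < √(2 * Real.pi)))
  refine h.congr' ?_
  filter_upwards [eventually_ge_atTop 2] with n hn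
  have hc := cSeq_pos hn
  rw [exp_half_cSeq_sq (by omega)]
  field_simp

theorem exp_half_gumbelLevel_sq {n : ℕ} (hn : 2 ≤ n) (x : ℝ) :
    Real.exp (gumbelLevel n x ^ 2 / 2) =
      n ^ 2 * Real.exp x / (4 * √Real.pi * cSeq n) * Real.exp (levelCorrection n x ^ 2 / 2) := by
  have hc := cSeq_pos hn
  have ht : √2 ^ 2 = (2 : ℝ) := Real.sq_sqrt (by norm_num)
  have h1 : gumbelLevel n x ^ 2 / 2 = cSeq n ^ 2 / 2 + cSeq n ^ 2 / 2 + x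
      - Real.log (4 * √Real.pi * cSeq n) + levelCorrection n x ^ 2 / 2 := by
    have h2 : √2 * cSeq n * levelCorrection n x = Real.log (4 * √Real.pi * cSeq n) - x := by
      rw [levelCorrection]; field_simp
    rw [gumbelLevel_eq]
    linear_combination (cSeq n ^ 2 / 2) * ht - h2
  rw [h1, Real.exp_add, Real.exp_sub, Real.exp_add, Real.exp_add, exp_half_cSeq_sq (by omega),
    Real.exp_log (by positivity)]
  ring

/-- There are about `n²/2` pairs, and the logarithmic term in the level cancels the Mills prefactor,
up to the factor `exp (w²/2) → 1`. -/
theorem tendsto_card_mul_gaussian_tail_gumbelLevel (x : ℝ) :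
    Tendsto (fun n : ℕ => (Fintype.card (UpperPair n) : ℝ) *
      (gaussianReal 0 1).real (Set.Ioi (gumbelLevel n x))) atTop (𝓝 (Real.exp (-x))) := by
  have h1 := tendsto_gaussianReal_real_Ioi_mul (tendsto_gumbelLevel x)
  have h2 : Tendsto (fun n : ℕ => (1 - 1 / (n : ℝ)) / 2) atTop (𝓝 (1 / 2)) := by
    simpa using (tendsto_one_div_atTop_nhds_zero_nat.const_sub (1 : ℝ)).div_const 2
  have h3 : Tendsto (fun n => (gumbelLevel n x / cSeq n)⁻¹) atTop (𝓝 (√2)⁻¹) :=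
    (tendsto_gumbelLevel_div_cSeq x).inv₀ (by positivity)
  have h4 : Tendsto (fun n => Real.exp (-(levelCorrection n x ^ 2 / 2))) atTop (𝓝 1) := by
    have := (((tendsto_levelCorrection x).pow 2).div_const 2).neg.rexp
    simpa using this
  have h5 := ((((h1.mul h2).mul h3).mul h4).mul_const (4 * √Real.pi / √(2 * Real.pi))).mul_const
    (Real.exp (-x))
  have e : 1 * (1 / 2) * (√2)⁻¹ * 1 * (4 * √Real.pi / √(2 * Real.pi)) * Real.exp (-x) =
      Real.exp (-x) := by
    rw [Real.sqrt_mul zero_le_two]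
    have ht : √2 ^ 2 = (2 : ℝ) := Real.sq_sqrt (by norm_num)
    field_simp
    linear_combination (-2) * ht
  rw [e] at h5
  refine h5.congr' ?_
  filter_upwards [eventually_ge_atTop 2, (tendsto_gumbelLevel x).eventually_gt_atTop 0] with n hn hu
  have hc := cSeq_pos hn
  have hn0 : (0 : ℝ) < n := by exact_mod_cast (by omega : 0 < n)
  have hN := UpperPair.two_mul_card n
  have hN' : (Fintype.card (UpperPair n) : ℝ) = n ^ 2 * ((1 - 1 / (n : ℝ)) / 2) := by
    field_simp
    linarith
  rw [exp_half_gumbelLevel_sq hn, hN', Real.exp_neg, Real.exp_neg]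
  field_simp

/-! ### Use of the growth hypothesis and conclusion. -/

/-- With `a = √2 √r ≤ 1`, `1 - 2r = (1 - a)(1 + a) ≤ 2 (1 - a)`, while `log c ≤ log log n` and
`√(log n) ≤ c` for large `n`. -/
theorem eventually_mul_log_cSeq_le {r : ℕ → ℝ} (hr : ∀ n, r n ∈ Set.Icc (0 : ℝ) (1 / 2))
    (hlim : Tendsto
      (fun n : ℕ => (1 - 2 * r n) * (√(Real.log n) / Real.log (Real.log n))) atTop atTop)
    {M : ℝ} (hM : 0 ≤ M) :
    ∀ᶠ n in atTop, M * Real.log (cSeq n) ≤ cSeq n * (1 - √2 * √(r n)) := by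
  have hlog : Tendsto (fun n : ℕ => Real.log n) atTop atTop :=
    Real.tendsto_log_atTop.comp tendsto_natCast_atTop_atTop
  filter_upwards [eventually_ge_atTop 2, hlim.eventually_ge_atTop (2 * M),
    hlog.eventually_ge_atTop 2] with n hn h1 h2
  have hl2 : 0 < Real.log 2 := Real.log_pos one_lt_two
  have hll : Real.log 2 ≤ Real.log (Real.log n) := Real.log_le_log two_pos h2
  have hL : Real.log (cSeq n) ≤ Real.log (Real.log n) := by
    rw [cSeq, Real.log_sqrt (by linarith), Real.log_mul two_ne_zero (by linarith)]
    linarith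
  rw [mul_div_assoc', le_div_iff₀ (by linarith)] at h1
  have hs1 : √2 * √(r n) ≤ 1 := by
    rw [← Real.sqrt_mul zero_le_two]
    exact Real.sqrt_le_one.2 (by linarith [(hr n).2])
  have hs0 : 0 ≤ √2 * √(r n) := by positivity
  have hsq : (√2 * √(r n)) ^ 2 = 2 * r n := by
    rw [mul_pow, Real.sq_sqrt zero_le_two, Real.sq_sqrt (hr n).1]
  have h3 : (1 - 2 * r n) / 2 ≤ 1 - √2 * √(r n) := by
    rw [← hsq]
    nlinarith
  have h4 : √(Real.log n) ≤ cSeq n := Real.sqrt_le_sqrt (by linarith)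
  have h5 : 0 ≤ √(Real.log n) := Real.sqrt_nonneg _
  calc M * Real.log (cSeq n) ≤ M * Real.log (Real.log n) := mul_le_mul_of_nonneg_left hL hM
    _ ≤ √(Real.log n) * ((1 - 2 * r n) / 2) := by linarith
    _ ≤ √(Real.log n) * (1 - √2 * √(r n)) := mul_le_mul_of_nonneg_left h3 h5
    _ ≤ cSeq n * (1 - √2 * √(r n)) := mul_le_mul_of_nonneg_right h4 (by linarith)

theorem tendsto_pairModelMeasure_real_forall_le {r : ℕ → ℝ}
    (hr : ∀ n, r n ∈ Set.Icc (0 : ℝ) (1 / 2))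
    (hlim : Tendsto
      (fun n : ℕ => (1 - 2 * r n) * (√(Real.log n) / Real.log (Real.log n))) atTop atTop) (x : ℝ) :
    Tendsto (fun n => (pairModelMeasure n).real
      {z | ∀ p, pairModel √(r n) √(1 - 2 * r n) p z ≤ gumbelLevel n x}) atTop
      (𝓝 (Real.exp (-Real.exp (-x)))) := by
  set A : ℕ → ℝ := fun n => (Fintype.card (UpperPair n) : ℝ) *
    (gaussianReal 0 1).real (Set.Ioi (gumbelLevel n x))
  have hA : Tendsto A atTop (𝓝 (Real.exp (-x))) := tendsto_card_mul_gaussian_tail_gumbelLevel x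
  -- This is `1 / c_n` for `n ≥ 2`, a common rate dominating every error term.
  set η : ℕ → ℝ := fun n => Real.exp (-Real.log (cSeq n))
  have hη : Tendsto η atTop (𝓝 0) :=
    Real.tendsto_exp_atBot.comp (tendsto_neg_atTop_atBot.comp tendsto_log_cSeq)
  have hbound : Tendsto (fun n => n * (gaussianReal 0 1).real (Set.Ioi (cSeq n)) +
      (2 * η n * A n + √((|A n - Real.exp (-x)| + 2 * η n) ^ 2 + η n * A n + 4 * η n)))
      atTop (𝓝 0) := by
    have h1 := ((((hA.sub_const (Real.exp (-x))).abs).add (hη.const_mul 2)).pow 2)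
    have h2 := ((h1.add (hη.mul hA)).add (hη.const_mul 4)).sqrt
    have h3 := tendsto_nat_mul_gaussian_tail_cSeq.add (((hη.const_mul 2).mul hA).add h2)
    simpa using h3
  rw [tendsto_iff_dist_tendsto_zero]
  refine squeeze_zero' (Eventually.of_forall fun _ => dist_nonneg) ?_ hbound
  filter_upwards [eventually_ge_atTop 2, eventually_levelCorrection_mul_le x,
    eventually_mul_log_cSeq_le hr hlim (M := 10) (by norm_num),
    tendsto_log_cSeq.eventually_ge_atTop 1,
    (tendsto_levelCorrection x).eventually_le_const (zero_lt_one),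
    hη.eventually_le_const (by norm_num : (0 : ℝ) < 1 / 2)] with n hn hw hδ hL hw1 hη1
  have hc := cSeq_pos hn
  have hn0 : (0 : ℝ) < n := by exact_mod_cast (by omega : 0 < n)
  have hρ : 0 ≤ √(r n) := Real.sqrt_nonneg _
  have hρ1 : √2 * √(r n) ≤ 1 := by
    rw [← Real.sqrt_mul zero_le_two]
    exact Real.sqrt_le_one.2 (by linarith [(hr n).2])
  have hone : 2 * √(r n) ^ 2 + √(1 - 2 * r n) ^ 2 = 1 := by
    rw [Real.sq_sqrt (hr n).1, Real.sq_sqrt (by linarith [(hr n).2])]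
    ring
  obtain ⟨α, β, hα, hβ, hK⟩ := exists_chernoff_exponent_truncated hρ hρ1 hc (by linarith) hw
  obtain ⟨α', β', hα', hβ', hK'⟩ := exists_chernoff_exponent_overlap hρ hρ1 hc (by linarith) hw
  set L := Real.log (cSeq n)
  set δ := cSeq n * (1 - √2 * √(r n)) with hδdef
  -- From `δ ≥ 10 L` and `L ≥ 1`. The two exponents below need `δ² ≥ 8L` and `δ² ≥ 70L`, so `M = 10`
  -- is ample.
  have hδ2 : 100 * L ≤ δ ^ 2 := by nlinarith
  have hε : Real.exp (2 * √(r n) * cSeq n - gumbelLevel n x + 1 / 2) ≤ η n := by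
    refine Real.exp_le_exp.2 ?_
    have ht : √2 ^ 2 = (2 : ℝ) := Real.sq_sqrt (by norm_num)
    have ht1 : (1.4 : ℝ) ≤ √2 := Real.le_sqrt_of_sq_le (by norm_num)
    have e : 2 * √(r n) * cSeq n - gumbelLevel n x + 1 / 2 =
        -(√2 * δ) + levelCorrection n x + 1 / 2 := by
      rw [gumbelLevel_eq, hδdef]
      linear_combination (-(√(r n) * cSeq n)) * ht
    rw [e]
    nlinarith
  have hK1 : Real.exp (-α * gumbelLevel n x - β * cSeq n +
      ((α * √(r n) + β) ^ 2 + α ^ 2 * (1 - √(r n) ^ 2)) / 2) ≤ η n / n ^ 2 := by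
    rw [← exp_half_cSeq_sq (n := n) (by omega), ← Real.exp_nat_mul, ← Real.exp_sub,
      gumbelLevel_eq]
    refine Real.exp_le_exp.2 (hK.trans ?_)
    push_cast
    linarith
  have hK2 : Real.exp (β' * cSeq n - 2 * α' * gumbelLevel n x + (2 * α' * √(r n) - β') ^ 2 / 2 +
      α' ^ 2 * (1 - √(r n) ^ 2)) ≤ η n / n ^ 3 := by
    rw [← exp_half_cSeq_sq (n := n) (by omega), ← Real.exp_nat_mul, ← Real.exp_sub,
      gumbelLevel_eq]
    refine Real.exp_le_exp.2 (hK'.trans ?_)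
    push_cast
    linarith
  have hmain := abs_pairModelMeasure_real_sub_exp_neg_le hρ hone (Real.exp_nonneg (-x)) hε hη1
    hα hβ hK1 hα' hβ' hK2 (A := A n) rfl
  rw [Real.dist_eq]
  refine hmain.trans ?_
  have hηn : 0 ≤ η n := Real.exp_nonneg _
  have hN : (Fintype.card (UpperPair n) : ℝ) * (η n / n ^ 2) ≤ η n := by
    have h1 := UpperPair.two_mul_card n
    rw [mul_div_assoc', div_le_iff₀ (by positivity), mul_comm (η n)]
    refine mul_le_mul_of_nonneg_right ?_ hηn
    nlinarith
  have hcube : 4 * (n : ℝ) ^ 3 * (η n / n ^ 3) = 4 * η n := by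
    field_simp
  rw [hcube]
  gcongr

theorem theorem1 {Ω : ℕ → Type*} [∀ n, MeasurableSpace (Ω n)]
    (P : (n : ℕ) → Measure (Ω n)) [∀ n, IsProbabilityMeasure (P n)]
    (r : ℕ → ℝ) (hr : ∀ n, r n ∈ Set.Icc (0 : ℝ) (1 / 2))
    (G : (n : ℕ) → UpperPair n → Ω n → ℝ)
    (hG : ∀ n, IsSparseEquicorrelatedField n (r n) (G n) (P n))
    (hlim : Tendsto
      (fun n : ℕ => (1 - 2 * r n) * (√(Real.log n) / Real.log (Real.log n))) atTop atTop) :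
    TendstoInDistribution
      (fun n ω => √2 * cSeq n *
        (fieldMax (G n) ω - √2 * cSeq n
          + Real.log (4 * √Real.pi * cSeq n) / (√2 * cSeq n)))
      atTop (id : ℝ → ℝ) P gumbelMeasure :=
  tendstoInDistribution_of_pairModel P r hr G hG
    (tendsto_pairModelMeasure_real_forall_le hr hlim)
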